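/- Let $(M_1,g_1)$ and $(M_2,g_2)$ be smooth finite-dimensional Riemannian manifolds without boundary, with Levi-Civita connections $\nabla^1,\nabla^2$, and suppose that $M_2=M_2(c)$ is a space form, i.e. its curvature operator $R(X,Y)Z=\nabla^2_X\nabla^2_YZ-\nabla^2_Y\nabla^2_XZ-\nabla^2_{[X,Y]}Z$ satisfies $R(X,Y)Z=c\{g_2(Y,Z)X-g_2(X,Z)Y\}$, with a constant $c\le 0$. For a smooth map $F:M_1\to M_2$ let $\nabla^F$ be the pullback of $\nabla^2$ to $F^{-1}TM_2$, let $(\nabla F_*)(X,Y)=\nabla^F_XF_*Y-F_*(\nabla^1_XY)$ be the second fundamental form of $F$, $\tau(F)=\operatorname{trace}\nabla F_*$ its tension field, and $$\tau^2(F)=\operatorname{trace}\big(\nabla^F\nabla^F-\nabla^F_{\nabla^1}\big)\tau(F)-\operatorname{trace}R(F_*\cdot,\tau(F))F_*\cdot$$ its bitension field. $F$ is harmonic if $\tau(F)=0$, biharmonic if $\tau^2(F)=0$, and proper biharmonic if it is biharmonic and not harmonic. A smooth map $F$ is a Riemannian map if $g_2(F_*X,F_*Y)=g_1(X,Y)$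 for all $p\in M_1$ and $X,Y\in(\ker F_{*p})^\perp$. For a Riemannian map $F$, let $H_2(p)=\frac1{\operatorname{rank}F_{*p}}\sum_i(\nabla F_*)(e_i,e_i)$, with $\{e_i\}$ an orthonormal basis of $(\ker F_{*p})^\perp$, be the mean curvature vector field of $\operatorname{range}F_*$ (and $H_2(p)=0$ where $F_{*p}=0$). For a section $V$ of $F^{-1}TM_2$ let $-A_VF_*X$ and $\nabla^{F\perp}_XV$ denote the components of $\nabla^F_XV$ in $\operatorname{range}F_*$ and in $(\operatorname{range}F_*)^\perp$. $F$ is pseudo-umbilical if there is $\lambda\in C^\infty(M_1)$ with $A_{H_2}F_*X=\lambda F_*X$ for all $X\in(\ker F_*)^\perp$. The field $H_2$ is parallel if $\nabla^{F\perp}_XH_2=0$ for all $X\in TM_1$. The distribution $\ker F_*$ is minimal if its mean curvature vector field, $\frac1q\sum_{r=1}^q$ of the component of $\nabla^1_{e_r}e_r$ in $(\ker F_*)^\perp$ for a local orthonormal frame $e_1,\dots,e_q$ of $\ker F_*$, vanishes (no condition where $q=0$). Then there is no proper biharmonic pseudo-umbilical Riemannian map $F:M_1\to M_2(c)$ such that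 the distribution $\ker F_*$ is minimal and $H_2$ is parallel. -/

import Mathlib

open Bundle
open scoped Manifold ContDiff

noncomputable section

namespace RiemMap

/-! ### Levi-Civita connection, pullback connection and curvature

A Riemannian manifold without boundary is a smooth manifold `M` modelled on a finite-dimensional
real vector space `E`, with a smooth family of inner products on its tangent spaces
(`RiemannianBundle` and `IsContMDiffRiemannianBundle` for the tangent bundle). -/

section Connection

variable {E : Type*} [NormedAddCommGroup E] [NormedSpace ℝ E]
  {M : Type*} [TopologicalSpace M] [ChartedSpace E M]

instance instFiniteDimensionalTangentSpace [FiniteDimensional ℝ E] (p : M) :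
    FiniteDimensional ℝ (TangentSpace 𝓘(ℝ, E) p) :=
  inferInstanceAs (FiniteDimensional ℝ E)

variable [IsManifold 𝓘(ℝ, E) ∞ M]

/-- The vector field, defined on the domain of the preferred chart at `p`, whose components in that
chart are constant and whose value at `p` is `v`. -/
def coordField (p : M) (v : TangentSpace 𝓘(ℝ, E) p) : Π q : M, TangentSpace 𝓘(ℝ, E) q :=
  fun q => (trivializationAt E (TangentSpace 𝓘(ℝ, E)) p).symm q
    ((trivializationAt E (TangentSpace 𝓘(ℝ, E)) p) ⟨p, v⟩).2

variable [FiniteDimensional ℝ E] [RiemannianBundle (fun p : M => TangentSpace 𝓘(ℝ, E) p)]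

/-- `koszulForm p u w z = g(∇_u W, z)` where `U`, `W`, `Z` are the vector fields extending
`u`, `w`, `z` with constant components in the chart at `p`: Koszul's formula (the Lie brackets of
such fields vanish), that is, the Christoffel symbol of the first kind. -/
def koszulForm (p : M) (u w z : TangentSpace 𝓘(ℝ, E) p) : ℝ :=
  (1 / 2) *
    (mvfderiv 𝓘(ℝ, E) (fun q => inner ℝ (coordField p w q) (coordField p z q)) p u
      + mvfderiv 𝓘(ℝ, E) (fun q => inner ℝ (coordField p u q) (coordField p z q)) p w
      - mvfderiv 𝓘(ℝ, E) (fun q => inner ℝ (coordField p u q) (coordField p w q)) p z)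

/-- The Christoffel symbol `Γ_p(u, w) = (∇_u W)(p)` of the Levi-Civita connection in the chart at
`p`, with `W` the field extending `w` with constant components in that chart. -/
def christoffel (p : M) (u w : TangentSpace 𝓘(ℝ, E) p) : TangentSpace 𝓘(ℝ, E) p :=
  ∑ i, koszulForm p u w (stdOrthonormalBasis ℝ (TangentSpace 𝓘(ℝ, E) p) i) •
    stdOrthonormalBasis ℝ (TangentSpace 𝓘(ℝ, E) p) i

/-- The Levi-Civita connection: `leviCivita X p v` is `∇_v X ∈ T_p M`; in the chart at `p` it is
`∂_v X + Γ(v, X)`. -/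
def leviCivita (X : Π q : M, TangentSpace 𝓘(ℝ, E) q) (p : M) (v : TangentSpace 𝓘(ℝ, E) p) :
    TangentSpace 𝓘(ℝ, E) p :=
  (trivializationAt E (TangentSpace 𝓘(ℝ, E)) p).symm p
      (mvfderiv 𝓘(ℝ, E)
        (fun q => ((trivializationAt E (TangentSpace 𝓘(ℝ, E)) p) ⟨q, X q⟩).2) p v)
    + christoffel p v (X p)

/-- The Riemann curvature operator
`R(x, y)z = ∇_X ∇_Y Z - ∇_Y ∇_X Z - ∇_[X,Y] Z` at `p`, computed with vector fields `X`, `Y`, `Z`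
extending `x`, `y`, `z ∈ T_p M`. -/
def curvature (p : M) (x y z : TangentSpace 𝓘(ℝ, E) p) : TangentSpace 𝓘(ℝ, E) p :=
  leviCivita (fun q => leviCivita (coordField p z) q (coordField p y q)) p x
    - leviCivita (fun q => leviCivita (coordField p z) q (coordField p x q)) p y
    - leviCivita (coordField p z) p
        (VectorField.mlieBracket 𝓘(ℝ, E) (coordField p x) (coordField p y) p)

variable (E M) in
/-- `M` is a space form `M(c)`: its curvature operator is
`R(X, Y)Z = c (g(Y, Z) X - g(X, Z) Y)`. -/
def IsSpaceForm (c : ℝ) : Prop :=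
  ∀ (p : M) (x y z : TangentSpace 𝓘(ℝ, E) p),
    curvature p x y z = c • (inner ℝ y z • x - inner ℝ x z • y)

/-! ### Second fundamental form and mean curvature of a distribution -/

/-- The unsymmetrized second fundamental form `A^D_v w = (∇_{D v} (D W))^⊥` of a distribution `D`
on `M`; here `D` also stands for the orthogonal projection onto `D`, `⊥` is the projection onto the
orthogonal distribution, and `W` is a vector field extending `w`. -/
def distA (D : Π q : M, Submodule ℝ (TangentSpace 𝓘(ℝ, E) q)) (p : M)
    (v w : TangentSpace 𝓘(ℝ, E) p) : TangentSpace 𝓘(ℝ, E) p :=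
  (D p)ᗮ.starProjection
    (leviCivita (fun q => (D q).starProjection (coordField p w q)) p ((D p).starProjection v))

/-- The symmetrized second fundamental form of a distribution. -/
def distB (D : Π q : M, Submodule ℝ (TangentSpace 𝓘(ℝ, E) q)) (p : M)
    (v w : TangentSpace 𝓘(ℝ, E) p) : TangentSpace 𝓘(ℝ, E) p :=
  (1 / 2 : ℝ) • (distA D p v w + distA D p w v)

/-- The mean curvature vector field of a distribution `D`: the trace of its second fundamental form
divided by the dimension of `D`. -/
def distMeanCurvature (D : Π q : M, Submodule ℝ (TangentSpace 𝓘(ℝ, E) q)) (p : M) :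
    TangentSpace 𝓘(ℝ, E) p :=
  (Module.finrank ℝ (D p) : ℝ)⁻¹ •
    ∑ i, distB D p (stdOrthonormalBasis ℝ (TangentSpace 𝓘(ℝ, E) p) i)
      (stdOrthonormalBasis ℝ (TangentSpace 𝓘(ℝ, E) p) i)

/-- A distribution is minimal if its mean curvature vector field vanishes. -/
def IsMinimalDistribution (D : Π q : M, Submodule ℝ (TangentSpace 𝓘(ℝ, E) q)) : Prop :=
  ∀ p : M, distMeanCurvature D p = 0

end Connection

/-! ### Maps between Riemannian manifolds -/

section Maps

variable {E₁ : Type*} [NormedAddCommGroup E₁] [NormedSpace ℝ E₁] [FiniteDimensional ℝ E₁]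
  {M₁ : Type*} [TopologicalSpace M₁] [ChartedSpace E₁ M₁] [IsManifold 𝓘(ℝ, E₁) ∞ M₁]
  [RiemannianBundle (fun p : M₁ => TangentSpace 𝓘(ℝ, E₁) p)]
  {E₂ : Type*} [NormedAddCommGroup E₂] [NormedSpace ℝ E₂] [FiniteDimensional ℝ E₂]
  {M₂ : Type*} [TopologicalSpace M₂] [ChartedSpace E₂ M₂] [IsManifold 𝓘(ℝ, E₂) ∞ M₂]
  [RiemannianBundle (fun p : M₂ => TangentSpace 𝓘(ℝ, E₂) p)]

variable (E₁ E₂)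

/-- The pullback along `F` of the Levi-Civita connection of `M₂`: for a section `V` of the pullback
bundle `F⁻¹(TM₂)` (a vector field along `F`) and `v ∈ T_p M₁`, `covAlong F V p v` is
`∇^F_v V ∈ T_{F(p)} M₂`; in the chart of `M₂` at `F(p)` it is `∂_v V + Γ(F_* v, V)`. -/
def covAlong (F : M₁ → M₂) (V : Π p : M₁, TangentSpace 𝓘(ℝ, E₂) (F p)) (p : M₁)
    (v : TangentSpace 𝓘(ℝ, E₁) p) : TangentSpace 𝓘(ℝ, E₂) (F p) :=
  (trivializationAt E₂ (TangentSpace 𝓘(ℝ, E₂)) (F p)).symm (F p)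
      (mvfderiv 𝓘(ℝ, E₁)
        (fun q => ((trivializationAt E₂ (TangentSpace 𝓘(ℝ, E₂)) (F p)) ⟨F q, V q⟩).2) p v)
    + christoffel (F p) (mfderiv 𝓘(ℝ, E₁) 𝓘(ℝ, E₂) F p v) (V p)

/-- The second fundamental form `(∇F_*)(v, w) = ∇^F_v (F_* W) - F_*(∇_v W)` of a map, with `W` a
vector field extending `w`. -/
def secondFF (F : M₁ → M₂) (p : M₁) (v w : TangentSpace 𝓘(ℝ, E₁) p) :
    TangentSpace 𝓘(ℝ, E₂) (F p) :=
  covAlong E₁ E₂ F (fun q => mfderiv 𝓘(ℝ, E₁) 𝓘(ℝ, E₂) F q (coordField p w q)) p v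
    - mfderiv 𝓘(ℝ, E₁) 𝓘(ℝ, E₂) F p (leviCivita (coordField p w) p v)

/-- The tension field `τ(F) = trace ∇F_*`. -/
def tension (F : M₁ → M₂) (p : M₁) : TangentSpace 𝓘(ℝ, E₂) (F p) :=
  ∑ i, secondFF E₁ E₂ F p (stdOrthonormalBasis ℝ (TangentSpace 𝓘(ℝ, E₁) p) i)
    (stdOrthonormalBasis ℝ (TangentSpace 𝓘(ℝ, E₁) p) i)

/-- The second covariant derivative `∇^F_v ∇^F_W V - ∇^F_{∇_v W} V` of a vector field `V` along
`F`, with `W` a vector field extending `w`. -/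
def secondCov (F : M₁ → M₂) (V : Π p : M₁, TangentSpace 𝓘(ℝ, E₂) (F p)) (p : M₁)
    (v w : TangentSpace 𝓘(ℝ, E₁) p) : TangentSpace 𝓘(ℝ, E₂) (F p) :=
  covAlong E₁ E₂ F (fun q => covAlong E₁ E₂ F V q (coordField p w q)) p v
    - covAlong E₁ E₂ F V p (leviCivita (coordField p w) p v)

/-- The (rough) Laplacian `Δ^F V = - trace (∇^F ∇^F - ∇^F_∇) V` on vector fields along `F`. -/
def laplacianAlong (F : M₁ → M₂) (V : Π p : M₁, TangentSpace 𝓘(ℝ, E₂) (F p)) (p : M₁) :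
    TangentSpace 𝓘(ℝ, E₂) (F p) :=
  - ∑ i, secondCov E₁ E₂ F V p (stdOrthonormalBasis ℝ (TangentSpace 𝓘(ℝ, E₁) p) i)
    (stdOrthonormalBasis ℝ (TangentSpace 𝓘(ℝ, E₁) p) i)

/-- The bitension field `τ²(F) = - Δ^F τ(F) - trace R(F_* ·, τ(F)) F_* ·`. -/
def bitension (F : M₁ → M₂) (p : M₁) : TangentSpace 𝓘(ℝ, E₂) (F p) :=
  - laplacianAlong E₁ E₂ F (tension E₁ E₂ F) p
    - ∑ i, curvature (F p)
        (mfderiv 𝓘(ℝ, E₁) 𝓘(ℝ, E₂) F p (stdOrthonormalBasis ℝ (TangentSpace 𝓘(ℝ, E₁) p) i))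
        (tension E₁ E₂ F p)
        (mfderiv 𝓘(ℝ, E₁) 𝓘(ℝ, E₂) F p (stdOrthonormalBasis ℝ (TangentSpace 𝓘(ℝ, E₁) p) i))

/-- `F` is harmonic: its tension field vanishes. -/
def IsHarmonic (F : M₁ → M₂) : Prop := ∀ p : M₁, tension E₁ E₂ F p = 0

/-- `F` is biharmonic: its bitension field vanishes. -/
def IsBiharmonic (F : M₁ → M₂) : Prop := ∀ p : M₁, bitension E₁ E₂ F p = 0

/-- `F` is proper biharmonic: biharmonic and not harmonic. -/
def IsProperBiharmonic (F : M₁ → M₂) : Prop := IsBiharmonic E₁ E₂ F ∧ ¬ IsHarmonic E₁ E₂ F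

/-! ### Riemannian maps -/

/-- The kernel distribution `ker F_*` on `M₁`. -/
def kerDist (F : M₁ → M₂) (p : M₁) : Submodule ℝ (TangentSpace 𝓘(ℝ, E₁) p) :=
  LinearMap.ker (mfderiv 𝓘(ℝ, E₁) 𝓘(ℝ, E₂) F p).toLinearMap

/-- `range F_*`, a subspace of `T_{F(p)} M₂` for each `p : M₁`. -/
def rangeDist (F : M₁ → M₂) (p : M₁) : Submodule ℝ (TangentSpace 𝓘(ℝ, E₂) (F p)) :=
  LinearMap.range (mfderiv 𝓘(ℝ, E₁) 𝓘(ℝ, E₂) F p).toLinearMap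

/-- A Riemannian map: a smooth map whose differential is isometric on the horizontal space
`(ker F_*)ᗮ` at each point. -/
def IsRiemannianMap (F : M₁ → M₂) : Prop :=
  ContMDiff 𝓘(ℝ, E₁) 𝓘(ℝ, E₂) ∞ F ∧
    ∀ (p : M₁), ∀ x ∈ (kerDist E₁ E₂ F p)ᗮ, ∀ y ∈ (kerDist E₁ E₂ F p)ᗮ,
      inner ℝ (mfderiv 𝓘(ℝ, E₁) 𝓘(ℝ, E₂) F p x) (mfderiv 𝓘(ℝ, E₁) 𝓘(ℝ, E₂) F p y) = inner ℝ x y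

/-- The mean curvature vector field `H₂` of `range F_*`, a vector field along `F`: the trace of
`∇F_*` over the horizontal space, divided by the rank of `F`. -/
def rangeMeanCurvature (F : M₁ → M₂) (p : M₁) : TangentSpace 𝓘(ℝ, E₂) (F p) :=
  (Module.finrank ℝ (rangeDist E₁ E₂ F p) : ℝ)⁻¹ •
    ∑ i, secondFF E₁ E₂ F p (stdOrthonormalBasis ℝ ↥(kerDist E₁ E₂ F p)ᗮ i : TangentSpace 𝓘(ℝ, E₁) p)
      (stdOrthonormalBasis ℝ ↥(kerDist E₁ E₂ F p)ᗮ i : TangentSpace 𝓘(ℝ, E₁) p)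

/-- `shapeOp F V p v` is `A_V (F_* v)`, minus the `range F_*` component of `∇^F_v V`. -/
def shapeOp (F : M₁ → M₂) (V : Π p : M₁, TangentSpace 𝓘(ℝ, E₂) (F p)) (p : M₁)
    (v : TangentSpace 𝓘(ℝ, E₁) p) : TangentSpace 𝓘(ℝ, E₂) (F p) :=
  - (rangeDist E₁ E₂ F p).starProjection (covAlong E₁ E₂ F V p v)

/-- The normal connection: `∇^{F⊥}_v V` is the `(range F_*)ᗮ` component of `∇^F_v V`. -/
def normalCov (F : M₁ → M₂) (V : Π p : M₁, TangentSpace 𝓘(ℝ, E₂) (F p)) (p : M₁)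
    (v : TangentSpace 𝓘(ℝ, E₁) p) : TangentSpace 𝓘(ℝ, E₂) (F p) :=
  (rangeDist E₁ E₂ F p)ᗮ.starProjection (covAlong E₁ E₂ F V p v)

/-- A vector field `V` along `F` is parallel for the normal connection: it is differentiable (so
that its covariant derivative makes sense) and `∇^{F⊥} V = 0`. -/
def IsNormalParallel (F : M₁ → M₂) (V : Π p : M₁, TangentSpace 𝓘(ℝ, E₂) (F p)) : Prop :=
  MDifferentiable 𝓘(ℝ, E₁) 𝓘(ℝ, E₂).tangent
      (fun p => (⟨F p, V p⟩ : TangentBundle 𝓘(ℝ, E₂) M₂)) ∧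
    ∀ (p : M₁) (v : TangentSpace 𝓘(ℝ, E₁) p), normalCov E₁ E₂ F V p v = 0

/-- `F` is pseudo-umbilical: `A_{H₂} F_* X = λ F_* X` for horizontal `X`, with `λ` a smooth function
on `M₁`. -/
def IsPseudoUmbilical (F : M₁ → M₂) : Prop :=
  ∃ l : M₁ → ℝ, ContMDiff 𝓘(ℝ, E₁) 𝓘(ℝ, ℝ) ∞ l ∧
    ∀ (p : M₁), ∀ x ∈ (kerDist E₁ E₂ F p)ᗮ,
      shapeOp E₁ E₂ F (rangeMeanCurvature E₁ E₂ F) p x = l p • mfderiv 𝓘(ℝ, E₁) 𝓘(ℝ, E₂) F p x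

end Maps

end RiemMap

end

/-!
Write `r` for the rank of `F`, `λ` for the umbilicity function, `H₂` for the mean curvature of
`range F_*` and `τ` for the tension field. The proof shows `∇^F H₂ = -λ F_*` and then reads off the
component along `H₂` of the bitension field.

* For a Riemannian map the horizontal projection is `F_*` composed with its adjoint
  (`IsRiemannianMap.inner_mfderiv`). Hence it is smooth, and its trace `r` is locally constant
  (`IsRiemannianMap.eventually_finrank_eq`).
* Differentiating `g₂(F_* Y, F_* Z) = g₁(Y, Z)` along horizontal fields shows that `∇F_*` is normal to
  `range F_*` on horizontal vectors (`IsRiemannianMap.inner_secondFF_mfderiv`), so `H₂` is normal. The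
  vertical part of the trace of `∇F_*` is `F_*` of a multiple of the mean curvature of `ker F_*`, so it
  vanishes, and `τ = r H₂` (`IsRiemannianMap.tension_eq`).
* Since `H₂` is parallel and `F` is pseudo-umbilical, `∇^F H₂ = -λ F_*`
  (`covAlong_rangeMeanCurvature`), and the trace of Weingarten's formula is `r λ = r |H₂|²`
  (`finrank_mul_eq`).
* Therefore `∇^F ∇^F τ = -r (dλ ⊗ F_* + λ ∇F_*)`. With the curvature of a space form,
  `g₂(τ²(F), H₂) = (c K - r λ) g₂(τ, H₂)` where `K = ∑ |F_* e_i|² ≥ 0`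
  (`inner_bitension_rangeMeanCurvature`). If `F` is biharmonic and `r H₂ ≠ 0` at some point, then
  `c K = r |H₂|² > 0` there, which contradicts `c ≤ 0`.

The connections are defined by a formula in the preferred charts at each point. All derivatives are
taken at a fixed point `p` in the charts at `p` and `F p`; covariant derivatives at nearby points enter
only through identities that hold at each point in its own chart, so no transformation rule between
charts is needed.
-/

noncomputable section

namespace RiemMap

open Filter Topology

/-! ### Coordinate fields and differentiation in charts -/

section Coord
variable {E : Type*} [NormedAddCommGroup E] [NormedSpace ℝ E]
  {M : Type*} [TopologicalSpace M] [ChartedSpace E M] [IsManifold 𝓘(ℝ, E) ∞ M]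

/-- The preferred trivialization at `p`, restricted to the fibre over `p`. As a map it is the identity
(`fiberEquiv_eq`), but it keeps vectors of `TangentSpace 𝓘(ℝ, E) p`, which carries the Riemannian norm,
apart from vectors of the model space `E`. -/
def fiberEquiv (p : M) : TangentSpace 𝓘(ℝ, E) p ≃L[ℝ] E :=
  (trivializationAt E (TangentSpace 𝓘(ℝ, E)) p).continuousLinearEquivAt ℝ p
    (FiberBundle.mem_baseSet_trivializationAt' p)

theorem fiberEquiv_apply (p : M) (v : TangentSpace 𝓘(ℝ, E) p) :
    fiberEquiv p v = ((trivializationAt E (TangentSpace 𝓘(ℝ, E)) p) ⟨p, v⟩).2 := rfl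

theorem fiberEquiv_eq (p : M) (v : TangentSpace 𝓘(ℝ, E) p) : fiberEquiv p v = v :=
  (tangentBundleCore 𝓘(ℝ, E) M).coordChange_self (achart E p) p (mem_chart_source E p) v

theorem coordField_eq_symmL (p : M) (v : TangentSpace 𝓘(ℝ, E) p) {q : M}
    (hq : q ∈ (trivializationAt E (TangentSpace 𝓘(ℝ, E)) p).baseSet) :
    coordField p v q =
      (trivializationAt E (TangentSpace 𝓘(ℝ, E)) p).symmL ℝ q (fiberEquiv p v) := by
  rw [Trivialization.symmL_apply _ hq]; rfl

theorem coordField_self (p : M) (v : TangentSpace 𝓘(ℝ, E) p) : coordField p v p = v :=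
  (fiberEquiv p).symm_apply_apply v

theorem trivializationAt_coordField (p : M) (v : TangentSpace 𝓘(ℝ, E) p) {q : M}
    (hq : q ∈ (trivializationAt E (TangentSpace 𝓘(ℝ, E)) p).baseSet) :
    ((trivializationAt E (TangentSpace 𝓘(ℝ, E)) p) ⟨q, coordField p v q⟩).2 = fiberEquiv p v := by
  rw [coordField, Trivialization.apply_mk_symm _ hq]; rfl

theorem eventually_mem_baseSet (p : M) :
    ∀ᶠ q in 𝓝 p, q ∈ (trivializationAt E (TangentSpace 𝓘(ℝ, E)) p).baseSet :=
  (trivializationAt E (TangentSpace 𝓘(ℝ, E)) p).open_baseSet.mem_nhds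
    (FiberBundle.mem_baseSet_trivializationAt' p)

theorem mdifferentiableAt_coordField (p : M) (v : TangentSpace 𝓘(ℝ, E) p) :
    MDifferentiableAt 𝓘(ℝ, E) 𝓘(ℝ, E).tangent
      (fun q => (⟨q, coordField p v q⟩ : TangentBundle 𝓘(ℝ, E) M)) p := by
  refine (mdifferentiableAt_section (IB := 𝓘(ℝ, E)) (F := E) (E := fun q : M => TangentSpace 𝓘(ℝ, E) q)
    (coordField p v)).2 ?_
  refine (mdifferentiableAt_const (c := fiberEquiv p v)).congr_of_eventuallyEq ?_
  filter_upwards [eventually_mem_baseSet (E := E) p] with q hq using trivializationAt_coordField p v hq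

end Coord

section Calc
variable {E : Type*} [NormedAddCommGroup E] [NormedSpace ℝ E]
  {M : Type*} [TopologicalSpace M] [ChartedSpace E M]
  {G : Type*} [NormedAddCommGroup G] [NormedSpace ℝ G]
  {G' : Type*} [NormedAddCommGroup G'] [NormedSpace ℝ G'] {p : M}

theorem _root_.MDifferentiableAt.mvfderiv_eq_fderiv [IsManifold 𝓘(ℝ, E) ∞ M] {f : M → G}
    (hf : MDifferentiableAt 𝓘(ℝ, E) 𝓘(ℝ, G) f p) (v : TangentSpace 𝓘(ℝ, E) p) :
    mvfderiv 𝓘(ℝ, E) f p v =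
      fderiv ℝ (f ∘ (extChartAt 𝓘(ℝ, E) p).symm) (extChartAt 𝓘(ℝ, E) p p) (fiberEquiv p v) := by
  have := hf.mvfderiv
  simp only [modelWithCornersSelf_coe, Set.range_id, fderivWithin_univ] at this
  rw [this, fiberEquiv_eq]; rfl

theorem mdifferentiableAt_iff_chart {f : M → G} :
    MDifferentiableAt 𝓘(ℝ, E) 𝓘(ℝ, G) f p ↔ ContinuousAt f p ∧
      DifferentiableAt ℝ (f ∘ (extChartAt 𝓘(ℝ, E) p).symm) (extChartAt 𝓘(ℝ, E) p p) := by
  rw [mdifferentiableAt_iff]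
  simp only [modelWithCornersSelf_coe, Set.range_id, differentiableWithinAt_univ]
  rfl

/-- The product rule for a family of linear maps applied to a family of vectors. -/
theorem mvfderiv_clm_apply [IsManifold 𝓘(ℝ, E) ∞ M] {A : M → G →L[ℝ] G'} {f : M → G}
    (hA : MDifferentiableAt 𝓘(ℝ, E) 𝓘(ℝ, G →L[ℝ] G') A p)
    (hf : MDifferentiableAt 𝓘(ℝ, E) 𝓘(ℝ, G) f p) (v : TangentSpace 𝓘(ℝ, E) p) :
    mvfderiv 𝓘(ℝ, E) (fun q => A q (f q)) p v =
      mvfderiv 𝓘(ℝ, E) A p v (f p) + A p (mvfderiv 𝓘(ℝ, E) f p v) := by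
  rw [hA.mvfderiv_eq_fderiv, hf.mvfderiv_eq_fderiv, (hA.clm_apply hf).mvfderiv_eq_fderiv]
  have h := fderiv_clm_apply (mdifferentiableAt_iff_chart.1 hA).2 (mdifferentiableAt_iff_chart.1 hf).2
  have h' := congr($h (fiberEquiv p v))
  rw [add_apply, ContinuousLinearMap.comp_apply,
    ContinuousLinearMap.flip_apply, add_comm] at h'
  simp only [Function.comp_apply, extChartAt_to_inv] at h'
  exact h'

theorem mvfderiv_congr {f g : M → G} (h : f =ᶠ[𝓝 p] g) :
    mvfderiv 𝓘(ℝ, E) f p = mvfderiv 𝓘(ℝ, E) g p := by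
  have := h.mfderiv_eq (I := 𝓘(ℝ, E)) (I' := 𝓘(ℝ, G))
  ext v
  simp only [mvfderiv, ContinuousLinearMap.comp_apply]
  rw [this]
  rfl

theorem mdifferentiableAt_clm_of_apply [FiniteDimensional ℝ G] {A : M → G →L[ℝ] G'}
    (h : ∀ w, MDifferentiableAt 𝓘(ℝ, E) 𝓘(ℝ, G') (fun q => A q w) p) :
    MDifferentiableAt 𝓘(ℝ, E) 𝓘(ℝ, G →L[ℝ] G') A p := by
  have key : A = fun q => ∑ i, (ContinuousLinearMap.smulRightL ℝ G G'
      ((Module.finBasis ℝ G).coord i).toContinuousLinearMap) (A q (Module.finBasis ℝ G i)) := by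
    ext q w
    conv_lhs => rw [← (Module.finBasis ℝ G).sum_repr w, map_sum]
    simp
  refine mdifferentiableAt_iff_chart.2 ⟨continuousAt_clm_apply.2 fun w => (h w).continuousAt, ?_⟩
  rw [key]
  refine DifferentiableAt.fun_sum (u := Finset.univ) fun i _ => ?_
  exact (ContinuousLinearMap.differentiableAt _).comp _ (mdifferentiableAt_iff_chart.1 (h _)).2

/-- If `A` is a differentiable family of linear isomorphisms and `A f` is differentiable, then so is
`f`, because inversion of linear isomorphisms is smooth. -/
theorem mdifferentiableAt_of_clm_apply_injective [FiniteDimensional ℝ G] {A : M → G →L[ℝ] G'}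
    {f : M → G} (hA : MDifferentiableAt 𝓘(ℝ, E) 𝓘(ℝ, G →L[ℝ] G') A p)
    (hinj : ∀ᶠ q in 𝓝 p, Function.Injective (A q)) [FiniteDimensional ℝ G']
    (hfin : Module.finrank ℝ G = Module.finrank ℝ G')
    (hAf : MDifferentiableAt 𝓘(ℝ, E) 𝓘(ℝ, G') (fun q => A q (f q)) p) :
    MDifferentiableAt 𝓘(ℝ, E) 𝓘(ℝ, G) f p := by
  have hex : ∀ q, Function.Injective (A q) → ∃ B : G ≃L[ℝ] G', (B : G →L[ℝ] G') = A q :=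
    fun q hq => ⟨(LinearEquiv.ofInjectiveOfFinrankEq (A q).toLinearMap hq
      hfin).toContinuousLinearEquiv, by ext; rfl⟩
  have hinv : MDifferentiableAt 𝓘(ℝ, E) 𝓘(ℝ, G' →L[ℝ] G)
      (fun q => ContinuousLinearMap.inverse (A q)) p := by
    obtain ⟨B, hB⟩ := hex p hinj.self_of_nhds
    have h1 : DifferentiableAt ℝ (ContinuousLinearMap.inverse : (G →L[ℝ] G') → _) (A p) := by
      rw [← hB]
      exact (contDiffAt_map_inverse (n := 1) B).differentiableAt one_ne_zero
    exact h1.comp_mdifferentiableAt hA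
  refine (hinv.clm_apply hAf).congr_of_eventuallyEq ?_
  filter_upwards [hinj] with q hq
  obtain ⟨B, hB⟩ := hex q hq
  rw [← hB, ContinuousLinearMap.inverse_equiv]
  exact (B.symm_apply_apply _).symm

end Calc

/-! ### The metric and the Christoffel symbols in a chart -/

section Shortcut
variable {E : Type*} [NormedAddCommGroup E] [NormedSpace ℝ E]

/-- A shortcut: in the presence of a Riemannian bundle the search for this instance is too slow. -/
instance instNormedAddCommGroupBilin : NormedAddCommGroup (E →L[ℝ] E →L[ℝ] ℝ) :=
  ContinuousLinearMap.toNormedAddCommGroup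

end Shortcut

section Metric
variable {E : Type*} [NormedAddCommGroup E] [NormedSpace ℝ E] [FiniteDimensional ℝ E]
  {M : Type*} [TopologicalSpace M] [ChartedSpace E M] [IsManifold 𝓘(ℝ, E) ∞ M]
  [RiemannianBundle (fun p : M => TangentSpace 𝓘(ℝ, E) p)]

/-- The metric at `q` in the chart at `p`: the bilinear form whose matrix is `(g_ij(q))`. For `q` outside
the domain of the chart it is zero. -/
def gram (p q : M) : E →L[ℝ] E →L[ℝ] ℝ :=
  LinearMap.toContinuousLinearMap
    ((LinearMap.toContinuousLinearMap (𝕜 := ℝ) (E := E) (F' := ℝ)).toLinearMap ∘ₗ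
      (innerₗ (TangentSpace 𝓘(ℝ, E) q)).compl₁₂
        ((trivializationAt E (TangentSpace 𝓘(ℝ, E)) p).symmL ℝ q).toLinearMap
        ((trivializationAt E (TangentSpace 𝓘(ℝ, E)) p).symmL ℝ q).toLinearMap)

theorem gram_apply (p q : M) (a b : E) :
    gram p q a b = inner ℝ ((trivializationAt E (TangentSpace 𝓘(ℝ, E)) p).symmL ℝ q a)
      ((trivializationAt E (TangentSpace 𝓘(ℝ, E)) p).symmL ℝ q b) := rfl

theorem gram_comm (p q : M) (a b : E) : gram p q a b = gram p q b a := by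
  rw [gram_apply, gram_apply, real_inner_comm]

theorem gram_self (p : M) (v w : TangentSpace 𝓘(ℝ, E) p) :
    gram p p (fiberEquiv p v) (fiberEquiv p w) = inner ℝ v w := by
  rw [gram_apply, ← coordField_eq_symmL p v (FiberBundle.mem_baseSet_trivializationAt' p),
    ← coordField_eq_symmL p w (FiberBundle.mem_baseSet_trivializationAt' p), coordField_self,
    coordField_self]

theorem gram_coordField (p : M) {q : M} (v w : TangentSpace 𝓘(ℝ, E) p)
    (hq : q ∈ (trivializationAt E (TangentSpace 𝓘(ℝ, E)) p).baseSet) :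
    gram p q (fiberEquiv p v) (fiberEquiv p w) = inner ℝ (coordField p v q) (coordField p w q) := by
  rw [gram_apply, coordField_eq_symmL p v hq, coordField_eq_symmL p w hq]

theorem gram_trivializationAt (p : M) {q : M}
    (hq : q ∈ (trivializationAt E (TangentSpace 𝓘(ℝ, E)) p).baseSet)
    (x y : TangentSpace 𝓘(ℝ, E) q) :
    gram p q (trivializationAt E (TangentSpace 𝓘(ℝ, E)) p ⟨q, x⟩).2
      (trivializationAt E (TangentSpace 𝓘(ℝ, E)) p ⟨q, y⟩).2 = inner ℝ x y := by
  rw [gram_apply, Trivialization.symmL_apply _ hq, Trivialization.symmL_apply _ hq,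
    Trivialization.symm_apply_apply_mk _ hq, Trivialization.symm_apply_apply_mk _ hq]

/-- The derivative `∂_u g(v, w)` at `p` of the components of the metric in the chart at `p`. -/
def gramDeriv (p : M) (u v w : TangentSpace 𝓘(ℝ, E) p) : ℝ :=
  mvfderiv 𝓘(ℝ, E) (gram p) p u (fiberEquiv p v) (fiberEquiv p w)

theorem gramDeriv_add_left (p : M) (u u' v w : TangentSpace 𝓘(ℝ, E) p) :
    gramDeriv p (u + u') v w = gramDeriv p u v w + gramDeriv p u' v w := by
  rw [gramDeriv, map_add]; rfl

theorem gramDeriv_smul_left (p : M) (a : ℝ) (u v w : TangentSpace 𝓘(ℝ, E) p) :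
    gramDeriv p (a • u) v w = a * gramDeriv p u v w := by
  rw [gramDeriv, map_smul]; rfl

theorem gramDeriv_add_middle (p : M) (u v v' w : TangentSpace 𝓘(ℝ, E) p) :
    gramDeriv p u (v + v') w = gramDeriv p u v w + gramDeriv p u v' w := by
  rw [gramDeriv, map_add, map_add]; rfl

theorem gramDeriv_smul_middle (p : M) (a : ℝ) (u v w : TangentSpace 𝓘(ℝ, E) p) :
    gramDeriv p u (a • v) w = a * gramDeriv p u v w := by
  rw [gramDeriv, map_smul, map_smul]; rfl

theorem gramDeriv_add_right (p : M) (u v w w' : TangentSpace 𝓘(ℝ, E) p) :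
    gramDeriv p u v (w + w') = gramDeriv p u v w + gramDeriv p u v w' := by
  rw [gramDeriv, map_add, map_add]; rfl

theorem gramDeriv_smul_right (p : M) (a : ℝ) (u v w : TangentSpace 𝓘(ℝ, E) p) :
    gramDeriv p u v (a • w) = a * gramDeriv p u v w := by
  rw [gramDeriv, map_smul, map_smul]; rfl

variable [IsContMDiffRiemannianBundle 𝓘(ℝ, E) ∞ E (fun p : M => TangentSpace 𝓘(ℝ, E) p)]

theorem mdifferentiableAt_gram (p : M) :
    MDifferentiableAt 𝓘(ℝ, E) 𝓘(ℝ, E →L[ℝ] E →L[ℝ] ℝ) (gram (E := E) p) p := by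
  refine mdifferentiableAt_clm_of_apply fun a => mdifferentiableAt_clm_of_apply fun b => ?_
  have h := MDifferentiableAt.inner_bundle (IB := 𝓘(ℝ, E)) (F := E)
    (E := fun q : M => TangentSpace 𝓘(ℝ, E) q) (b := fun q : M => q)
    (mdifferentiableAt_coordField p ((fiberEquiv p).symm a))
    (mdifferentiableAt_coordField p ((fiberEquiv p).symm b))
  refine h.congr_of_eventuallyEq ?_
  filter_upwards [eventually_mem_baseSet (E := E) p] with q hq
  rw [← gram_coordField p _ _ hq]
  simp

theorem mvfderiv_gram_apply (p : M) (u : TangentSpace 𝓘(ℝ, E) p) (a b : E) :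
    mvfderiv 𝓘(ℝ, E) (fun q => gram p q a b) p u = mvfderiv 𝓘(ℝ, E) (gram p) p u a b := by
  have hG := mdifferentiableAt_gram (E := E) p
  have ha : MDifferentiableAt 𝓘(ℝ, E) 𝓘(ℝ, E) (fun _ : M => a) p := mdifferentiableAt_const
  have hb : MDifferentiableAt 𝓘(ℝ, E) 𝓘(ℝ, E) (fun _ : M => b) p := mdifferentiableAt_const
  rw [mvfderiv_clm_apply (hG.clm_apply ha) hb, mvfderiv_clm_apply hG ha]
  simp [mvfderiv_const]

theorem mvfderiv_inner_coordField (p : M) (u v w : TangentSpace 𝓘(ℝ, E) p) :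
    mvfderiv 𝓘(ℝ, E) (fun q => inner ℝ (coordField p v q) (coordField p w q)) p u =
      gramDeriv p u v w := by
  rw [gramDeriv, ← mvfderiv_gram_apply]
  congr 1
  refine mvfderiv_congr ?_
  filter_upwards [eventually_mem_baseSet (E := E) p] with q hq using (gram_coordField p v w hq).symm

theorem gramDeriv_comm (p : M) (u v w : TangentSpace 𝓘(ℝ, E) p) :
    gramDeriv p u v w = gramDeriv p u w v := by
  simp only [gramDeriv, ← mvfderiv_gram_apply, gram_comm p _ (fiberEquiv p v)]

theorem koszulForm_eq (p : M) (u w z : TangentSpace 𝓘(ℝ, E) p) :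
    koszulForm p u w z = 1 / 2 * (gramDeriv p u w z + gramDeriv p w u z - gramDeriv p z u w) := by
  simp only [koszulForm, mvfderiv_inner_coordField]

theorem koszulForm_comm (p : M) (u w z : TangentSpace 𝓘(ℝ, E) p) :
    koszulForm p u w z = koszulForm p w u z := by
  rw [koszulForm_eq, koszulForm_eq, gramDeriv_comm p z u w]; ring

/-- The Levi-Civita connection is metric, in terms of Christoffel symbols. -/
theorem koszulForm_add_koszulForm (p : M) (u w z : TangentSpace 𝓘(ℝ, E) p) :
    koszulForm p u w z + koszulForm p u z w = gramDeriv p u w z := by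
  rw [koszulForm_eq, koszulForm_eq, gramDeriv_comm p u z w, gramDeriv_comm p w u z]
  ring

/-- The Christoffel symbol of the second kind is the metric dual of that of the first kind. -/
theorem inner_christoffel (p : M) (u w z : TangentSpace 𝓘(ℝ, E) p) :
    inner ℝ (christoffel p u w) z = koszulForm p u w z := by
  let b := stdOrthonormalBasis ℝ (TangentSpace 𝓘(ℝ, E) p)
  let L : TangentSpace 𝓘(ℝ, E) p →ₗ[ℝ] ℝ :=
    { toFun := koszulForm p u w
      map_add' := fun z z' => by
        simp only [koszulForm_eq, gramDeriv_add_left, gramDeriv_add_right]; ring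
      map_smul' := fun a z => by
        simp only [koszulForm_eq, gramDeriv_smul_left, gramDeriv_smul_right, smul_eq_mul,
          RingHom.id_apply]; ring }
  change _ = L z
  conv_rhs => rw [← b.sum_repr z, map_sum]
  rw [christoffel, sum_inner]
  refine Finset.sum_congr rfl fun i _ => ?_
  rw [real_inner_smul_left, map_smul, smul_eq_mul, b.repr_apply_apply, mul_comm]
  rfl

/-- The Levi-Civita connection is torsion free. -/
theorem christoffel_comm (p : M) (u w : TangentSpace 𝓘(ℝ, E) p) :
    christoffel p u w = christoffel p w u := by
  simp only [christoffel, koszulForm_comm p u w]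

theorem christoffel_add_left (p : M) (u u' w : TangentSpace 𝓘(ℝ, E) p) :
    christoffel p (u + u') w = christoffel p u w + christoffel p u' w := by
  refine ext_inner_right ℝ fun z => ?_
  simp only [inner_add_left, inner_christoffel, koszulForm_eq, gramDeriv_add_left,
    gramDeriv_add_middle]
  ring

theorem christoffel_smul_left (p : M) (a : ℝ) (u w : TangentSpace 𝓘(ℝ, E) p) :
    christoffel p (a • u) w = a • christoffel p u w := by
  refine ext_inner_right ℝ fun z => ?_
  simp only [real_inner_smul_left, inner_christoffel, koszulForm_eq, gramDeriv_smul_left,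
    gramDeriv_smul_middle]
  ring

theorem christoffel_add_right (p : M) (u w w' : TangentSpace 𝓘(ℝ, E) p) :
    christoffel p u (w + w') = christoffel p u w + christoffel p u w' := by
  simp only [christoffel_comm p u, christoffel_add_left]

theorem christoffel_smul_right (p : M) (a : ℝ) (u w : TangentSpace 𝓘(ℝ, E) p) :
    christoffel p u (a • w) = a • christoffel p u w := by
  simp only [christoffel_comm p u, christoffel_smul_left]

/-- A vector field is differentiable at `p` if its inner products with the coordinate fields are: the
matrix of the metric can be inverted differentiably. -/
theorem mdifferentiableAt_of_inner_coordField {X : Π q : M, TangentSpace 𝓘(ℝ, E) q} {p : M}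
    (h : ∀ z : TangentSpace 𝓘(ℝ, E) p,
      MDifferentiableAt 𝓘(ℝ, E) 𝓘(ℝ, ℝ) (fun q => inner ℝ (X q) (coordField p z q)) p) :
    MDifferentiableAt 𝓘(ℝ, E) 𝓘(ℝ, E).tangent
      (fun q => (⟨q, X q⟩ : TangentBundle 𝓘(ℝ, E) M)) p := by
  refine (mdifferentiableAt_section (IB := 𝓘(ℝ, E)) (F := E)
    (E := fun q : M => TangentSpace 𝓘(ℝ, E) q) X).2 ?_
  set e := trivializationAt E (TangentSpace 𝓘(ℝ, E)) p with he
  have hinj : ∀ q ∈ e.baseSet, Function.Injective (gram (E := E) p q) := by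
    intro q hq
    refine (injective_iff_map_eq_zero _).2 fun a ha => ?_
    have h0 : gram (E := E) p q a a = 0 := by rw [ha]; rfl
    rw [gram_apply, inner_self_eq_zero] at h0
    exact (e.continuousLinearMapAt_symmL (R := ℝ) hq a).symm.trans
      ((congrArg (e.continuousLinearMapAt ℝ q) h0).trans (map_zero _))
  have hfin : Module.finrank ℝ E = Module.finrank ℝ (E →L[ℝ] ℝ) := by
    rw [← (LinearMap.toContinuousLinearMap (𝕜 := ℝ) (E := E) (F' := ℝ)).finrank_eq]
    exact (Subspace.dual_finrank_eq (K := ℝ) (V := E)).symm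
  refine mdifferentiableAt_of_clm_apply_injective (mdifferentiableAt_gram (E := E) p)
    ((eventually_mem_baseSet (E := E) p).mono hinj) hfin ?_
  refine mdifferentiableAt_clm_of_apply fun z => ?_
  refine (h ((fiberEquiv p).symm z)).congr_of_eventuallyEq ?_
  filter_upwards [eventually_mem_baseSet (E := E) p] with q hq
  rw [← gram_trivializationAt p hq, trivializationAt_coordField p _ hq,
    ContinuousLinearEquiv.apply_symm_apply]

end Metric

/-! ### The pullback connection and the Hessian in charts -/

section Along
variable {E₁ : Type*} [NormedAddCommGroup E₁] [NormedSpace ℝ E₁]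
  {M₁ : Type*} [TopologicalSpace M₁] [ChartedSpace E₁ M₁]
  {E₂ : Type*} [NormedAddCommGroup E₂] [NormedSpace ℝ E₂] [FiniteDimensional ℝ E₂]
  {M₂ : Type*} [TopologicalSpace M₂] [ChartedSpace E₂ M₂] [IsManifold 𝓘(ℝ, E₂) ∞ M₂]
  [RiemannianBundle (fun p : M₂ => TangentSpace 𝓘(ℝ, E₂) p)]
  {F : M₁ → M₂} {V W : Π p : M₁, TangentSpace 𝓘(ℝ, E₂) (F p)} {p : M₁}

theorem covAlong_eq (v : TangentSpace 𝓘(ℝ, E₁) p) :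
    covAlong E₁ E₂ F V p v = (fiberEquiv (F p)).symm (mvfderiv 𝓘(ℝ, E₁)
        (fun q => ((trivializationAt E₂ (TangentSpace 𝓘(ℝ, E₂)) (F p)) ⟨F q, V q⟩).2) p v)
      + christoffel (F p) (mfderiv 𝓘(ℝ, E₁) 𝓘(ℝ, E₂) F p v) (V p) := rfl

theorem covAlong_congr (h : ∀ᶠ q in 𝓝 p, V q = W q) (v : TangentSpace 𝓘(ℝ, E₁) p) :
    covAlong E₁ E₂ F V p v = covAlong E₁ E₂ F W p v := by
  rw [covAlong_eq, covAlong_eq, h.self_of_nhds]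
  congr 3
  refine mvfderiv_congr ?_
  filter_upwards [h] with q hq
  rw [hq]

variable [IsContMDiffRiemannianBundle 𝓘(ℝ, E₂) ∞ E₂ (fun p : M₂ => TangentSpace 𝓘(ℝ, E₂) p)]

theorem covAlong_add_apply (v w : TangentSpace 𝓘(ℝ, E₁) p) :
    covAlong E₁ E₂ F V p (v + w) = covAlong E₁ E₂ F V p v + covAlong E₁ E₂ F V p w := by
  simp only [covAlong_eq, map_add, christoffel_add_left]
  abel

/-- The Leibniz rule for the pullback connection. -/
theorem covAlong_smul {f : M₁ → ℝ} (hf : MDifferentiableAt 𝓘(ℝ, E₁) 𝓘(ℝ, ℝ) f p)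
    (hV : MDifferentiableAt 𝓘(ℝ, E₁) 𝓘(ℝ, E₂).tangent
      (fun q => (⟨F q, V q⟩ : TangentBundle 𝓘(ℝ, E₂) M₂)) p) (v : TangentSpace 𝓘(ℝ, E₁) p) :
    covAlong E₁ E₂ F (fun q => f q • V q) p v =
      mvfderiv 𝓘(ℝ, E₁) f p v • V p + f p • covAlong E₁ E₂ F V p v := by
  obtain ⟨hF, hV'⟩ := (mdifferentiableAt_totalSpace 𝓘(ℝ, E₂) _).1 hV
  have hev : ∀ᶠ q in 𝓝 p, F q ∈ (trivializationAt E₂ (TangentSpace 𝓘(ℝ, E₂)) (F p)).baseSet :=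
    hF.continuousAt.eventually (eventually_mem_baseSet (E := E₂) (F p))
  have h1 : mvfderiv 𝓘(ℝ, E₁) (fun q => ((trivializationAt E₂ (TangentSpace 𝓘(ℝ, E₂)) (F p))
      ⟨F q, f q • V q⟩).2) p = mvfderiv 𝓘(ℝ, E₁) (f • fun q =>
      ((trivializationAt E₂ (TangentSpace 𝓘(ℝ, E₂)) (F p)) ⟨F q, V q⟩).2) p := by
    refine mvfderiv_congr ?_
    filter_upwards [hev] with q hq
    exact ((trivializationAt E₂ (TangentSpace 𝓘(ℝ, E₂)) (F p)).linear ℝ hq).map_smul _ _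
  rw [covAlong_eq, covAlong_eq, h1, mvfderiv_smul hf hV', christoffel_smul_right]
  simp only [add_apply, smul_apply, map_add, map_smul, smul_add, ContinuousLinearMap.smulRight_apply]
  rw [← fiberEquiv_apply, ContinuousLinearEquiv.symm_apply_apply]
  abel

variable [IsManifold 𝓘(ℝ, E₁) ∞ M₁]

/-- The pullback connection is compatible with the metric. -/
theorem mvfderiv_inner
    (hV : MDifferentiableAt 𝓘(ℝ, E₁) 𝓘(ℝ, E₂).tangent
      (fun q => (⟨F q, V q⟩ : TangentBundle 𝓘(ℝ, E₂) M₂)) p)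
    (hW : MDifferentiableAt 𝓘(ℝ, E₁) 𝓘(ℝ, E₂).tangent
      (fun q => (⟨F q, W q⟩ : TangentBundle 𝓘(ℝ, E₂) M₂)) p) (v : TangentSpace 𝓘(ℝ, E₁) p) :
    mvfderiv 𝓘(ℝ, E₁) (fun q => inner ℝ (V q) (W q)) p v =
      inner ℝ (covAlong E₁ E₂ F V p v) (W p) + inner ℝ (V p) (covAlong E₁ E₂ F W p v) := by
  obtain ⟨hF, hV'⟩ := (mdifferentiableAt_totalSpace 𝓘(ℝ, E₂) _).1 hV
  obtain ⟨-, hW'⟩ := (mdifferentiableAt_totalSpace 𝓘(ℝ, E₂) _).1 hW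
  have hev : ∀ᶠ q in 𝓝 p, F q ∈ (trivializationAt E₂ (TangentSpace 𝓘(ℝ, E₂)) (F p)).baseSet :=
    hF.continuousAt.eventually (eventually_mem_baseSet (E := E₂) (F p))
  have hG := mdifferentiableAt_gram (E := E₂) (F p)
  have hGF : MDifferentiableAt 𝓘(ℝ, E₁) 𝓘(ℝ, E₂ →L[ℝ] E₂ →L[ℝ] ℝ)
    (fun q => gram (E := E₂) (F p) (F q)) p := hG.comp p hF
  have hchain : mvfderiv 𝓘(ℝ, E₁) (fun q => gram (E := E₂) (F p) (F q)) p v =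
      mvfderiv 𝓘(ℝ, E₂) (gram (E := E₂) (F p)) (F p) (mfderiv 𝓘(ℝ, E₁) 𝓘(ℝ, E₂) F p v) :=
    mfderiv_comp_apply p hG hF v
  have h1 : mvfderiv 𝓘(ℝ, E₁) (fun q => inner ℝ (V q) (W q)) p =
      mvfderiv 𝓘(ℝ, E₁) (fun q => gram (E := E₂) (F p) (F q)
        ((trivializationAt E₂ (TangentSpace 𝓘(ℝ, E₂)) (F p)) ⟨F q, V q⟩).2
        ((trivializationAt E₂ (TangentSpace 𝓘(ℝ, E₂)) (F p)) ⟨F q, W q⟩).2) p := by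
    refine mvfderiv_congr ?_
    filter_upwards [hev] with q hq using (gram_trivializationAt (F p) hq _ _).symm
  rw [h1, mvfderiv_clm_apply (hGF.clm_apply hV') hW', mvfderiv_clm_apply hGF hV', hchain]
  rw [covAlong_eq, covAlong_eq, inner_add_left, inner_add_right, real_inner_comm _ (V p),
    real_inner_comm _ (V p), inner_christoffel, inner_christoffel]
  have hk := koszulForm_add_koszulForm (F p) (mfderiv 𝓘(ℝ, E₁) 𝓘(ℝ, E₂) F p v) (V p) (W p)
  rw [gramDeriv] at hk
  rw [← gram_self, ← gram_self, ContinuousLinearEquiv.apply_symm_apply,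
    ContinuousLinearEquiv.apply_symm_apply, gram_comm _ _ _ (fiberEquiv (F p) (V p))]
  simp only [add_apply, ← fiberEquiv_apply]
  linarith

end Along

section Tangent
variable {E : Type*} [NormedAddCommGroup E] [NormedSpace ℝ E] [FiniteDimensional ℝ E]
  {M : Type*} [TopologicalSpace M] [ChartedSpace E M] [IsManifold 𝓘(ℝ, E) ∞ M]
  [RiemannianBundle (fun p : M => TangentSpace 𝓘(ℝ, E) p)]

/-- The Levi-Civita connection is its own pullback along the identity. -/
theorem leviCivita_eq_covAlong (X : Π q : M, TangentSpace 𝓘(ℝ, E) q) (p : M)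
    (v : TangentSpace 𝓘(ℝ, E) p) :
    leviCivita X p v = covAlong E E (fun q : M => q) X p v := by
  rw [covAlong, leviCivita]
  have : mfderiv 𝓘(ℝ, E) 𝓘(ℝ, E) (fun q : M => q) p v = v := by
    rw [show (fun q : M => q) = id from rfl, mfderiv_id]; rfl
  rw [this]

theorem leviCivita_eq (X : Π q : M, TangentSpace 𝓘(ℝ, E) q) (p : M)
    (v : TangentSpace 𝓘(ℝ, E) p) :
    leviCivita X p v = (fiberEquiv p).symm (mvfderiv 𝓘(ℝ, E)
        (fun q => ((trivializationAt E (TangentSpace 𝓘(ℝ, E)) p) ⟨q, X q⟩).2) p v)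
      + christoffel p v (X p) := rfl

end Tangent

section Push
variable {E₁ : Type*} [NormedAddCommGroup E₁] [NormedSpace ℝ E₁]
  {M₁ : Type*} [TopologicalSpace M₁] [ChartedSpace E₁ M₁] [IsManifold 𝓘(ℝ, E₁) ∞ M₁]
  {E₂ : Type*} [NormedAddCommGroup E₂] [NormedSpace ℝ E₂]
  {M₂ : Type*} [TopologicalSpace M₂] [ChartedSpace E₂ M₂] [IsManifold 𝓘(ℝ, E₂) ∞ M₂]
  {F : M₁ → M₂} {p : M₁}

variable (E₁ E₂) in
/-- The Jacobian of `F` at `q` in the charts at `p` and at `F p`. -/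
def jacobian (F : M₁ → M₂) (p q : M₁) : E₁ →L[ℝ] E₂ :=
  (trivializationAt E₂ (TangentSpace 𝓘(ℝ, E₂)) (F p)).continuousLinearMapAt ℝ (F q) ∘L
    mfderiv 𝓘(ℝ, E₁) 𝓘(ℝ, E₂) F q ∘L
    (trivializationAt E₁ (TangentSpace 𝓘(ℝ, E₁)) p).symmL ℝ q

theorem mdifferentiableAt_jacobian (hF : ContMDiff 𝓘(ℝ, E₁) 𝓘(ℝ, E₂) ∞ F) (p : M₁) :
    MDifferentiableAt 𝓘(ℝ, E₁) 𝓘(ℝ, E₁ →L[ℝ] E₂) (jacobian E₁ E₂ F p) p :=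
  ((hF.contMDiffAt (x := p)).mfderiv_const (m := 1) (by norm_cast)).mdifferentiableAt one_ne_zero

theorem trivializationAt_mfderiv {q : M₁}
    (hq : q ∈ (trivializationAt E₁ (TangentSpace 𝓘(ℝ, E₁)) p).baseSet)
    (hq' : F q ∈ (trivializationAt E₂ (TangentSpace 𝓘(ℝ, E₂)) (F p)).baseSet)
    (x : TangentSpace 𝓘(ℝ, E₁) q) :
    (trivializationAt E₂ (TangentSpace 𝓘(ℝ, E₂)) (F p)
      ⟨F q, mfderiv 𝓘(ℝ, E₁) 𝓘(ℝ, E₂) F q x⟩).2 =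
    jacobian E₁ E₂ F p q (trivializationAt E₁ (TangentSpace 𝓘(ℝ, E₁)) p ⟨q, x⟩).2 := by
  rw [jacobian, ContinuousLinearMap.comp_apply, ContinuousLinearMap.comp_apply,
    Trivialization.continuousLinearMapAt_apply_of_mem (R := ℝ) _ hq', Trivialization.symmL_apply _ hq,
    Trivialization.symm_apply_apply_mk _ hq]

theorem jacobian_self (v : TangentSpace 𝓘(ℝ, E₁) p) :
    jacobian E₁ E₂ F p p (fiberEquiv p v) = fiberEquiv (F p) (mfderiv 𝓘(ℝ, E₁) 𝓘(ℝ, E₂) F p v) :=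
  (trivializationAt_mfderiv (FiberBundle.mem_baseSet_trivializationAt' p)
    (FiberBundle.mem_baseSet_trivializationAt' (F p)) v).symm

theorem mdifferentiableAt_mfderiv_apply (hF : ContMDiff 𝓘(ℝ, E₁) 𝓘(ℝ, E₂) ∞ F)
    {X : Π q : M₁, TangentSpace 𝓘(ℝ, E₁) q}
    (hX : MDifferentiableAt 𝓘(ℝ, E₁) 𝓘(ℝ, E₁).tangent
      (fun q => (⟨q, X q⟩ : TangentBundle 𝓘(ℝ, E₁) M₁)) p) :
    MDifferentiableAt 𝓘(ℝ, E₁) 𝓘(ℝ, E₂).tangent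
      (fun q => (⟨F q, mfderiv 𝓘(ℝ, E₁) 𝓘(ℝ, E₂) F q (X q)⟩ : TangentBundle 𝓘(ℝ, E₂) M₂)) p := by
  have hFp : MDifferentiableAt 𝓘(ℝ, E₁) 𝓘(ℝ, E₂) F p := hF.contMDiffAt.mdifferentiableAt (by simp)
  refine (mdifferentiableAt_totalSpace 𝓘(ℝ, E₂) _).2 ⟨hFp, ?_⟩
  refine ((mdifferentiableAt_jacobian hF p).clm_apply
    ((mdifferentiableAt_totalSpace 𝓘(ℝ, E₁) _).1 hX).2).congr_of_eventuallyEq ?_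
  filter_upwards [eventually_mem_baseSet (E := E₁) p,
    hFp.continuousAt.eventually (eventually_mem_baseSet (E := E₂) (F p))] with q hq hq'
    using trivializationAt_mfderiv hq hq' _

/-- The second derivative of `F` in charts is symmetric. -/
theorem mvfderiv_jacobian_comm (hF : ContMDiff 𝓘(ℝ, E₁) 𝓘(ℝ, E₂) ∞ F)
    (v w : TangentSpace 𝓘(ℝ, E₁) p) :
    mvfderiv 𝓘(ℝ, E₁) (jacobian E₁ E₂ F p) p v (fiberEquiv p w) =
      mvfderiv 𝓘(ℝ, E₁) (jacobian E₁ E₂ F p) p w (fiberEquiv p v) := by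
  set φ := extChartAt 𝓘(ℝ, E₁) p with hφ
  set Fh : E₁ → E₂ := writtenInExtChartAt 𝓘(ℝ, E₁) 𝓘(ℝ, E₂) p F with hFh
  have hFp : ContinuousAt F p := hF.continuous.continuousAt
  have hcd : ContDiffAt ℝ ∞ Fh (φ p) := by
    have := (contMDiffAt_iff.1 (hF.contMDiffAt (x := p))).2
    rw [modelWithCornersSelf_coe, Set.range_id] at this
    exact contDiffWithinAt_univ.1 this
  have htgt : ∀ᶠ y in 𝓝 (φ p), y ∈ φ.target := extChartAt_target_mem_nhds p
  have hsymm : ContinuousAt φ.symm (φ p) := continuousAt_extChartAt_symm p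
  have hsymm' : Tendsto φ.symm (𝓝 (φ p)) (𝓝 p) := by
    have := hsymm.tendsto
    rwa [extChartAt_to_inv] at this
  -- In the charts `jacobian F p` is the derivative of the coordinate expression of `F`.
  have hjac : jacobian E₁ E₂ F p ∘ φ.symm =ᶠ[𝓝 (φ p)] fderiv ℝ Fh := by
    filter_upwards [htgt, hsymm'.eventually (hFp.eventually
      ((chartAt E₂ (F p)).open_source.mem_nhds (mem_chart_source E₂ (F p)))),
      hsymm'.eventually ((chartAt E₁ p).open_source.mem_nhds (mem_chart_source E₁ p))]
      with y hy hFy hy'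
    have h := inTangentCoordinates_eq_mfderiv_comp (I := 𝓘(ℝ, E₁)) (I' := 𝓘(ℝ, E₂)) (f := id)
      (g := F) (ϕ := fun q => mfderiv 𝓘(ℝ, E₁) 𝓘(ℝ, E₂) F q) (x₀ := p) (x := φ.symm y) hy' hFy
    have h2 : jacobian E₁ E₂ F p (φ.symm y) = _ := h
    rw [Function.comp_apply, h2]
    have h1 : MDifferentiableAt 𝓘(ℝ, E₁) 𝓘(ℝ, E₁) φ.symm y := by
      have := mdifferentiableWithinAt_extChartAt_symm (I := 𝓘(ℝ, E₁)) hy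
      rwa [modelWithCornersSelf_coe, Set.range_id, mdifferentiableWithinAt_univ] at this
    have h3 : MDifferentiableAt 𝓘(ℝ, E₁) 𝓘(ℝ, E₂) F (φ.symm y) :=
      hF.contMDiffAt.mdifferentiableAt (by simp)
    have h4 : MDifferentiableAt 𝓘(ℝ, E₂) 𝓘(ℝ, E₂) (extChartAt 𝓘(ℝ, E₂) (F p)) (F (φ.symm y)) :=
      mdifferentiableAt_extChartAt hFy
    have h5 := h4.hasMFDerivAt.comp y (h3.hasMFDerivAt.comp y h1.hasMFDerivAt)
    have h6 : fderiv ℝ Fh y = mfderiv 𝓘(ℝ, E₁) 𝓘(ℝ, E₂) Fh y := mfderiv_eq_fderiv.symm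
    rw [h6]
    refine Eq.trans ?_ h5.mfderiv.symm
    simp only [id, modelWithCornersSelf_coe, Set.range_id, mfderivWithin_univ]
    rw [← hφ, φ.right_inv hy]
    rfl
  have hsym : IsSymmSndFDerivAt ℝ Fh (φ p) := hcd.isSymmSndFDerivAt (by
    rw [minSmoothness_of_isRCLikeNormedField]; exact ENat.LEInfty.out)
  have hj := mdifferentiableAt_jacobian hF p
  rw [hj.mvfderiv_eq_fderiv, hj.mvfderiv_eq_fderiv, hjac.fderiv_eq]
  exact hsym _ _

end Push

/-! ### Traces of bilinear maps -/

section LinearAlgebra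
variable {V : Type*} [NormedAddCommGroup V] [InnerProductSpace ℝ V]
  {W : Type*} [AddCommGroup W] [Module ℝ W] {ι κ : Type*} [Fintype ι] [Fintype κ]

theorem sum_bilin_apply_left_eq (B : V →ₗ[ℝ] V →ₗ[ℝ] W) (b : OrthonormalBasis ι ℝ V)
    {T : V →ₗ[ℝ] V} (hT : T.IsSymmetric) : ∑ i, B (T (b i)) (b i) = ∑ i, B (b i) (T (b i)) := by
  have h1 : ∀ i, B (T (b i)) (b i) = ∑ j, inner ℝ (b j) (T (b i)) • B (b j) (b i) := fun i => by
    conv_lhs => rw [← b.sum_repr' (T (b i))]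
    simp
  have h2 : ∀ i, B (b i) (T (b i)) = ∑ j, inner ℝ (b j) (T (b i)) • B (b i) (b j) := fun i => by
    conv_lhs => rw [← b.sum_repr' (T (b i))]
    simp
  simp only [h1, h2]
  rw [Finset.sum_comm]
  refine Finset.sum_congr rfl fun i _ => Finset.sum_congr rfl fun j _ => ?_
  rw [← hT, real_inner_comm]

variable [FiniteDimensional ℝ V]

theorem sum_bilin_starProjection (B : V →ₗ[ℝ] V →ₗ[ℝ] W) (b : OrthonormalBasis ι ℝ V)
    (U : Submodule ℝ V) (c : OrthonormalBasis κ ℝ U) :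
    ∑ i, B (U.starProjection (b i)) (U.starProjection (b i)) = ∑ k, B (c k) (c k) := by
  classical
  have h1 : ∀ x : V, U.starProjection x = ∑ k, inner ℝ (c k : V) x • (c k : V) := fun x => by
    rw [Submodule.starProjection_apply, ← c.sum_repr' (U.orthogonalProjectionOnto x)]
    push_cast
    refine Finset.sum_congr rfl fun k _ => ?_
    congr 1
    rw [Submodule.coe_inner, ← Submodule.starProjection_apply,
      ← Submodule.inner_starProjection_left_eq_right,
      Submodule.starProjection_eq_self_iff.2 (c k).2]
  have h2 : ∀ i, B (U.starProjection (b i)) (U.starProjection (b i)) =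
      ∑ k, ∑ l, (inner ℝ (c k : V) (b i) * inner ℝ (b i) (c l : V)) • B (c k) (c l) := fun i => by
    rw [h1]
    simp only [map_sum, map_smul, LinearMap.sum_apply, LinearMap.smul_apply, Finset.smul_sum,
      smul_smul]
    rw [Finset.sum_comm]
    refine Finset.sum_congr rfl fun k _ => Finset.sum_congr rfl fun l _ => ?_
    rw [real_inner_comm (c l : V), mul_comm]
  simp only [h2]
  rw [Finset.sum_comm]
  refine Finset.sum_congr rfl fun k _ => ?_
  rw [Finset.sum_comm]
  simp only [← Finset.sum_smul, b.sum_inner_mul_inner, ← Submodule.coe_inner,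
    orthonormal_iff_ite.1 c.orthonormal, ite_smul, one_smul, zero_smul, Finset.sum_ite_eq,
    Finset.mem_univ, if_true]

/-- The trace of a bilinear map splits along an orthogonal decomposition `V = K ⊕ Kᗮ`. -/
theorem sum_bilin_eq_add (B : V →ₗ[ℝ] V →ₗ[ℝ] W) (b : OrthonormalBasis ι ℝ V)
    (K : Submodule ℝ V) (c : OrthonormalBasis κ ℝ Kᗮ) :
    ∑ i, B (b i) (b i) = ∑ i, B (K.starProjection (b i)) (K.starProjection (b i)) +
      ∑ k, B (c k) (c k) := by
  have hcross : ∀ (U U' : Submodule ℝ V), (∀ x, U.starProjection (U'.starProjection x) = 0) →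
      ∑ i, B (U'.starProjection (b i)) (U.starProjection (b i)) = 0 := fun U U' h => by
    have := sum_bilin_apply_left_eq (B.compl₂ (U.starProjection : V →ₗ[ℝ] V)) b
      (T := (U'.starProjection : V →ₗ[ℝ] V)) U'.starProjection_isSymmetric
    simp only [LinearMap.compl₂_apply, ContinuousLinearMap.coe_coe, h, map_zero,
      Finset.sum_const_zero] at this
    exact this
  rw [← sum_bilin_starProjection B b Kᗮ c]
  have h3 : ∀ i, B (b i) (b i) =
      B (K.starProjection (b i)) (K.starProjection (b i)) +
      B (Kᗮ.starProjection (b i)) (Kᗮ.starProjection (b i)) +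
      (B (K.starProjection (b i)) (Kᗮ.starProjection (b i)) +
      B (Kᗮ.starProjection (b i)) (K.starProjection (b i))) := fun i => by
    conv_lhs => rw [← K.starProjection_add_starProjection_orthogonal (b i)]
    simp only [map_add, LinearMap.add_apply]
    abel
  simp only [h3, Finset.sum_add_distrib]
  rw [hcross Kᗮ K fun x => ?_, hcross K Kᗮ fun x => ?_, add_zero, add_zero]
  · exact (Submodule.starProjection_apply_eq_zero_iff K).2 (Submodule.starProjection_apply_mem _ x)
  · refine (Submodule.starProjection_apply_eq_zero_iff Kᗮ).2 ?_
    exact K.le_orthogonal_orthogonal (Submodule.starProjection_apply_mem _ x)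

theorem trace_starProjection (U : Submodule ℝ V) :
    LinearMap.trace ℝ V (U.starProjection : V →ₗ[ℝ] V) = Module.finrank ℝ U := by
  refine LinearMap.IsProj.trace (p := U) ⟨fun x => U.starProjection_apply_mem x, fun x hx => ?_⟩
  exact Submodule.starProjection_eq_self_iff.2 hx

end LinearAlgebra

/-! ### The second fundamental form of a map and the horizontal projection -/

section Kernel
variable {E₁ : Type*} [NormedAddCommGroup E₁] [NormedSpace ℝ E₁]
  {M₁ : Type*} [TopologicalSpace M₁] [ChartedSpace E₁ M₁]
  {E₂ : Type*} [NormedAddCommGroup E₂] [NormedSpace ℝ E₂]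
  {M₂ : Type*} [TopologicalSpace M₂] [ChartedSpace E₂ M₂]
  {F : M₁ → M₂} {p : M₁}

theorem mfderiv_eq_zero_of_mem_kerDist {x : TangentSpace 𝓘(ℝ, E₁) p} (hx : x ∈ kerDist E₁ E₂ F p) :
    mfderiv 𝓘(ℝ, E₁) 𝓘(ℝ, E₂) F p x = 0 := hx

variable [FiniteDimensional ℝ E₁] [RiemannianBundle (fun p : M₁ => TangentSpace 𝓘(ℝ, E₁) p)]

variable (F) in
theorem mfderiv_horizontal (x : TangentSpace 𝓘(ℝ, E₁) p) :
    mfderiv 𝓘(ℝ, E₁) 𝓘(ℝ, E₂) F p ((kerDist E₁ E₂ F p)ᗮ.starProjection x) =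
      mfderiv 𝓘(ℝ, E₁) 𝓘(ℝ, E₂) F p x := by
  have h := (kerDist E₁ E₂ F p).starProjection_add_starProjection_orthogonal x
  conv_rhs => rw [← h, map_add]
  rw [mfderiv_eq_zero_of_mem_kerDist (Submodule.starProjection_apply_mem _ x), zero_add]

variable (F) in
theorem finrank_rangeDist (p : M₁) :
    Module.finrank ℝ (rangeDist E₁ E₂ F p) = Module.finrank ℝ (kerDist E₁ E₂ F p)ᗮ := by
  have h1 := (mfderiv 𝓘(ℝ, E₁) 𝓘(ℝ, E₂) F p).toLinearMap.finrank_range_add_finrank_ker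
  have h2 := (kerDist E₁ E₂ F p).finrank_add_finrank_orthogonal
  rw [rangeDist]
  rw [kerDist] at h2 ⊢
  omega

variable [RiemannianBundle (fun p : M₂ => TangentSpace 𝓘(ℝ, E₂) p)]

/-- For a Riemannian map the pullback of the metric is the metric composed with the horizontal projection,
that is, the horizontal projection is `F_*` composed with its adjoint. -/
theorem IsRiemannianMap.inner_mfderiv (h : IsRiemannianMap E₁ E₂ F) (x y : TangentSpace 𝓘(ℝ, E₁) p) :
    inner ℝ (mfderiv 𝓘(ℝ, E₁) 𝓘(ℝ, E₂) F p x) (mfderiv 𝓘(ℝ, E₁) 𝓘(ℝ, E₂) F p y) =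
      inner ℝ ((kerDist E₁ E₂ F p)ᗮ.starProjection x) y := by
  rw [← mfderiv_horizontal F x, ← mfderiv_horizontal F y,
    h.2 p _ (Submodule.starProjection_apply_mem _ x) _ (Submodule.starProjection_apply_mem _ y),
    ← Submodule.inner_starProjection_left_eq_right,
    Submodule.starProjection_eq_self_iff.2 (Submodule.starProjection_apply_mem _ x)]

end Kernel

section SecondFF
variable {E₁ : Type*} [NormedAddCommGroup E₁] [NormedSpace ℝ E₁] [FiniteDimensional ℝ E₁]
  {M₁ : Type*} [TopologicalSpace M₁] [ChartedSpace E₁ M₁] [IsManifold 𝓘(ℝ, E₁) ∞ M₁]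
  [RiemannianBundle (fun p : M₁ => TangentSpace 𝓘(ℝ, E₁) p)]
  {E₂ : Type*} [NormedAddCommGroup E₂] [NormedSpace ℝ E₂] [FiniteDimensional ℝ E₂]
  {M₂ : Type*} [TopologicalSpace M₂] [ChartedSpace E₂ M₂] [IsManifold 𝓘(ℝ, E₂) ∞ M₂]
  [RiemannianBundle (fun p : M₂ => TangentSpace 𝓘(ℝ, E₂) p)]
  {F : M₁ → M₂} {p : M₁}

/-- The Hessian of `F` along a vector field `X`, in charts; the right side depends on `X p` only. -/
theorem covAlong_mfderiv_sub (hF : ContMDiff 𝓘(ℝ, E₁) 𝓘(ℝ, E₂) ∞ F)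
    {X : Π q : M₁, TangentSpace 𝓘(ℝ, E₁) q}
    (hX : MDifferentiableAt 𝓘(ℝ, E₁) 𝓘(ℝ, E₁).tangent
      (fun q => (⟨q, X q⟩ : TangentBundle 𝓘(ℝ, E₁) M₁)) p) (v : TangentSpace 𝓘(ℝ, E₁) p) :
    covAlong E₁ E₂ F (fun q => mfderiv 𝓘(ℝ, E₁) 𝓘(ℝ, E₂) F q (X q)) p v
        - mfderiv 𝓘(ℝ, E₁) 𝓘(ℝ, E₂) F p (leviCivita X p v) =
      (fiberEquiv (F p)).symm
          (mvfderiv 𝓘(ℝ, E₁) (jacobian E₁ E₂ F p) p v (fiberEquiv p (X p)))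
        + christoffel (F p) (mfderiv 𝓘(ℝ, E₁) 𝓘(ℝ, E₂) F p v)
          (mfderiv 𝓘(ℝ, E₁) 𝓘(ℝ, E₂) F p (X p))
        - mfderiv 𝓘(ℝ, E₁) 𝓘(ℝ, E₂) F p (christoffel p v (X p)) := by
  have hFp : MDifferentiableAt 𝓘(ℝ, E₁) 𝓘(ℝ, E₂) F p := hF.contMDiffAt.mdifferentiableAt (by simp)
  have hX' := ((mdifferentiableAt_totalSpace 𝓘(ℝ, E₁) _).1 hX).2
  have h1 : mvfderiv 𝓘(ℝ, E₁) (fun q => ((trivializationAt E₂ (TangentSpace 𝓘(ℝ, E₂)) (F p))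
        ⟨F q, mfderiv 𝓘(ℝ, E₁) 𝓘(ℝ, E₂) F q (X q)⟩).2) p =
      mvfderiv 𝓘(ℝ, E₁) (fun q => jacobian E₁ E₂ F p q
        (trivializationAt E₁ (TangentSpace 𝓘(ℝ, E₁)) p ⟨q, X q⟩).2) p := by
    refine mvfderiv_congr ?_
    filter_upwards [eventually_mem_baseSet (E := E₁) p,
      hFp.continuousAt.eventually (eventually_mem_baseSet (E := E₂) (F p))] with q hq hq'
      using trivializationAt_mfderiv hq hq' _
  have h2 : ∀ a : E₁, (fiberEquiv (F p)).symm (jacobian E₁ E₂ F p p a) =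
      mfderiv 𝓘(ℝ, E₁) 𝓘(ℝ, E₂) F p ((fiberEquiv p).symm a) := fun a => by
    have := jacobian_self (E₁ := E₁) (E₂ := E₂) (F := F) ((fiberEquiv p).symm a)
    rw [ContinuousLinearEquiv.apply_symm_apply] at this
    rw [this, ContinuousLinearEquiv.symm_apply_apply]
  rw [covAlong_eq, h1, mvfderiv_clm_apply (mdifferentiableAt_jacobian hF p) hX', leviCivita_eq,
    map_add, map_add, h2, ← fiberEquiv_apply]
  abel

theorem secondFF_eq (hF : ContMDiff 𝓘(ℝ, E₁) 𝓘(ℝ, E₂) ∞ F) (v w : TangentSpace 𝓘(ℝ, E₁) p) :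
    secondFF E₁ E₂ F p v w =
      (fiberEquiv (F p)).symm
          (mvfderiv 𝓘(ℝ, E₁) (jacobian E₁ E₂ F p) p v (fiberEquiv p w))
        + christoffel (F p) (mfderiv 𝓘(ℝ, E₁) 𝓘(ℝ, E₂) F p v)
          (mfderiv 𝓘(ℝ, E₁) 𝓘(ℝ, E₂) F p w)
        - mfderiv 𝓘(ℝ, E₁) 𝓘(ℝ, E₂) F p (christoffel p v w) := by
  have h := covAlong_mfderiv_sub hF (mdifferentiableAt_coordField p w) v
  rw [coordField_self] at h
  exact h

/-- The second fundamental form is a tensor: `∇^F_v (F_* X) = (∇F_*)(v, X) + F_*(∇_v X)` for every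
differentiable vector field `X`, not just for coordinate fields. -/
theorem covAlong_mfderiv (hF : ContMDiff 𝓘(ℝ, E₁) 𝓘(ℝ, E₂) ∞ F)
    {X : Π q : M₁, TangentSpace 𝓘(ℝ, E₁) q}
    (hX : MDifferentiableAt 𝓘(ℝ, E₁) 𝓘(ℝ, E₁).tangent
      (fun q => (⟨q, X q⟩ : TangentBundle 𝓘(ℝ, E₁) M₁)) p) (v : TangentSpace 𝓘(ℝ, E₁) p) :
    covAlong E₁ E₂ F (fun q => mfderiv 𝓘(ℝ, E₁) 𝓘(ℝ, E₂) F q (X q)) p v =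
      secondFF E₁ E₂ F p v (X p) + mfderiv 𝓘(ℝ, E₁) 𝓘(ℝ, E₂) F p (leviCivita X p v) := by
  rw [secondFF_eq hF, ← covAlong_mfderiv_sub hF hX, sub_add_cancel]

variable (F) in
/-- `r H₂` is the horizontal trace of `∇F_*`, also where the rank `r` is zero. -/
theorem finrank_smul_rangeMeanCurvature (p : M₁) :
    (Module.finrank ℝ (rangeDist E₁ E₂ F p) : ℝ) • rangeMeanCurvature E₁ E₂ F p =
      ∑ i, secondFF E₁ E₂ F p
        (stdOrthonormalBasis ℝ ↥(kerDist E₁ E₂ F p)ᗮ i : TangentSpace 𝓘(ℝ, E₁) p)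
        (stdOrthonormalBasis ℝ ↥(kerDist E₁ E₂ F p)ᗮ i : TangentSpace 𝓘(ℝ, E₁) p) := by
  rw [rangeMeanCurvature]
  by_cases hr : Module.finrank ℝ (rangeDist E₁ E₂ F p) = 0
  · rw [hr, Nat.cast_zero, zero_smul]
    symm
    refine Finset.sum_eq_zero fun i _ => ?_
    rw [finrank_rangeDist] at hr
    exact (Fin.cast hr i).elim0
  · rw [smul_inv_smul₀ (Nat.cast_ne_zero.2 hr)]

variable [IsContMDiffRiemannianBundle 𝓘(ℝ, E₁) ∞ E₁ (fun p : M₁ => TangentSpace 𝓘(ℝ, E₁) p)]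
  [IsContMDiffRiemannianBundle 𝓘(ℝ, E₂) ∞ E₂ (fun p : M₂ => TangentSpace 𝓘(ℝ, E₂) p)]

theorem secondFF_comm (hF : ContMDiff 𝓘(ℝ, E₁) 𝓘(ℝ, E₂) ∞ F) (v w : TangentSpace 𝓘(ℝ, E₁) p) :
    secondFF E₁ E₂ F p v w = secondFF E₁ E₂ F p w v := by
  rw [secondFF_eq hF, secondFF_eq hF, mvfderiv_jacobian_comm hF, christoffel_comm p,
    christoffel_comm (F p)]

theorem secondFF_add_right (hF : ContMDiff 𝓘(ℝ, E₁) 𝓘(ℝ, E₂) ∞ F)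
    (v w w' : TangentSpace 𝓘(ℝ, E₁) p) :
    secondFF E₁ E₂ F p v (w + w') = secondFF E₁ E₂ F p v w + secondFF E₁ E₂ F p v w' := by
  simp only [secondFF_eq hF, map_add, christoffel_add_right]
  abel

theorem secondFF_smul_right (hF : ContMDiff 𝓘(ℝ, E₁) 𝓘(ℝ, E₂) ∞ F) (a : ℝ)
    (v w : TangentSpace 𝓘(ℝ, E₁) p) :
    secondFF E₁ E₂ F p v (a • w) = a • secondFF E₁ E₂ F p v w := by
  simp only [secondFF_eq hF, map_smul, christoffel_smul_right, smul_add, smul_sub]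

variable (p) in
/-- The second fundamental form of a smooth map as a bilinear map. -/
def secondFFBilin (hF : ContMDiff 𝓘(ℝ, E₁) 𝓘(ℝ, E₂) ∞ F) :
    TangentSpace 𝓘(ℝ, E₁) p →ₗ[ℝ] TangentSpace 𝓘(ℝ, E₁) p →ₗ[ℝ] TangentSpace 𝓘(ℝ, E₂) (F p) :=
  LinearMap.mk₂ ℝ (secondFF E₁ E₂ F p)
    (fun v v' w => by rw [secondFF_comm hF, secondFF_add_right hF, secondFF_comm hF w,
      secondFF_comm hF w])
    (fun a v w => by rw [secondFF_comm hF, secondFF_smul_right hF, secondFF_comm hF w])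
    (secondFF_add_right hF) (fun a v w => secondFF_smul_right hF a v w)

theorem secondFFBilin_apply (hF : ContMDiff 𝓘(ℝ, E₁) 𝓘(ℝ, E₂) ∞ F)
    (v w : TangentSpace 𝓘(ℝ, E₁) p) :
    secondFFBilin p hF v w = secondFF E₁ E₂ F p v w := rfl

/-- The horizontal projection of a Riemannian map depends differentiably on the point, since it is
expressed by the metrics and the differential of `F`. -/
theorem IsRiemannianMap.mdifferentiableAt_horizontal (h : IsRiemannianMap E₁ E₂ F)
    (w : TangentSpace 𝓘(ℝ, E₁) p) :
    MDifferentiableAt 𝓘(ℝ, E₁) 𝓘(ℝ, E₁).tangent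
      (fun q => (⟨q, (kerDist E₁ E₂ F q)ᗮ.starProjection (coordField p w q)⟩ :
        TangentBundle 𝓘(ℝ, E₁) M₁)) p := by
  refine mdifferentiableAt_of_inner_coordField fun z => ?_
  simp only [← h.inner_mfderiv]
  exact MDifferentiableAt.inner_bundle (IB := 𝓘(ℝ, E₂)) (F := E₂)
    (E := fun q : M₂ => TangentSpace 𝓘(ℝ, E₂) q) (b := F)
    (mdifferentiableAt_mfderiv_apply h.1 (mdifferentiableAt_coordField p w))
    (mdifferentiableAt_mfderiv_apply h.1 (mdifferentiableAt_coordField p z))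

theorem IsRiemannianMap.mdifferentiableAt_vertical (h : IsRiemannianMap E₁ E₂ F)
    (w : TangentSpace 𝓘(ℝ, E₁) p) :
    MDifferentiableAt 𝓘(ℝ, E₁) 𝓘(ℝ, E₁).tangent
      (fun q => (⟨q, (kerDist E₁ E₂ F q).starProjection (coordField p w q)⟩ :
        TangentBundle 𝓘(ℝ, E₁) M₁)) p := by
  have hs := mdifferentiableAt_sub_section (I := 𝓘(ℝ, E₁)) (F := E₁)
    (E := fun q : M₁ => TangentSpace 𝓘(ℝ, E₁) q)
    (mdifferentiableAt_coordField p w) (h.mdifferentiableAt_horizontal w)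
  refine hs.congr_of_eventuallyEq (Eventually.of_forall fun q => ?_)
  have := (kerDist E₁ E₂ F q).starProjection_add_starProjection_orthogonal (coordField p w q)
  simp only [Pi.sub_apply]
  rw [eq_sub_of_add_eq this]

end SecondFF

/-! ### The second fundamental form and mean curvature of a Riemannian map -/

section RiemannianMaps
variable {E₁ : Type*} [NormedAddCommGroup E₁] [NormedSpace ℝ E₁] [FiniteDimensional ℝ E₁]
  {M₁ : Type*} [TopologicalSpace M₁] [ChartedSpace E₁ M₁] [IsManifold 𝓘(ℝ, E₁) ∞ M₁]
  [RiemannianBundle (fun p : M₁ => TangentSpace 𝓘(ℝ, E₁) p)]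
  [IsContMDiffRiemannianBundle 𝓘(ℝ, E₁) ∞ E₁ (fun p : M₁ => TangentSpace 𝓘(ℝ, E₁) p)]
  {E₂ : Type*} [NormedAddCommGroup E₂] [NormedSpace ℝ E₂] [FiniteDimensional ℝ E₂]
  {M₂ : Type*} [TopologicalSpace M₂] [ChartedSpace E₂ M₂] [IsManifold 𝓘(ℝ, E₂) ∞ M₂]
  [RiemannianBundle (fun p : M₂ => TangentSpace 𝓘(ℝ, E₂) p)]
  [IsContMDiffRiemannianBundle 𝓘(ℝ, E₂) ∞ E₂ (fun p : M₂ => TangentSpace 𝓘(ℝ, E₂) p)]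
  {F : M₁ → M₂} {p : M₁}

/-- The derivative of `g₂(F_* Y, F_* Z) = g₁(Y, Z)` along horizontal fields `Y` and `Z`. -/
theorem IsRiemannianMap.inner_secondFF_add (h : IsRiemannianMap E₁ E₂ F)
    (v : TangentSpace 𝓘(ℝ, E₁) p) {y z : TangentSpace 𝓘(ℝ, E₁) p}
    (hy : y ∈ (kerDist E₁ E₂ F p)ᗮ) (hz : z ∈ (kerDist E₁ E₂ F p)ᗮ) :
    inner ℝ (secondFF E₁ E₂ F p v y) (mfderiv 𝓘(ℝ, E₁) 𝓘(ℝ, E₂) F p z) +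
      inner ℝ (secondFF E₁ E₂ F p v z) (mfderiv 𝓘(ℝ, E₁) 𝓘(ℝ, E₂) F p y) = 0 := by
  set X : TangentSpace 𝓘(ℝ, E₁) p → Π q : M₁, TangentSpace 𝓘(ℝ, E₁) q :=
    fun w q => (kerDist E₁ E₂ F q)ᗮ.starProjection (coordField p w q) with hXdef
  have hX : ∀ w, MDifferentiableAt 𝓘(ℝ, E₁) 𝓘(ℝ, E₁).tangent
      (fun q => (⟨q, X w q⟩ : TangentBundle 𝓘(ℝ, E₁) M₁)) p := h.mdifferentiableAt_horizontal
  have hXp : ∀ w ∈ (kerDist E₁ E₂ F p)ᗮ, X w p = w := fun w hw => by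
    simp only [hXdef, coordField_self]
    exact Submodule.starProjection_eq_self_iff.2 hw
  have hfun : (fun q => inner ℝ (mfderiv 𝓘(ℝ, E₁) 𝓘(ℝ, E₂) F q (X y q))
      (mfderiv 𝓘(ℝ, E₁) 𝓘(ℝ, E₂) F q (X z q))) = fun q => inner ℝ (X y q) (X z q) := by
    funext q
    rw [h.inner_mfderiv, Submodule.starProjection_eq_self_iff.2]
    exact Submodule.starProjection_apply_mem _ _
  have h1 := mvfderiv_inner (mdifferentiableAt_mfderiv_apply h.1 (hX y))
    (mdifferentiableAt_mfderiv_apply h.1 (hX z)) v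
  have h2 := mvfderiv_inner (F := fun q : M₁ => q) (hX y) (hX z) v
  rw [hfun, h2, covAlong_mfderiv h.1 (hX y), covAlong_mfderiv h.1 (hX z),
    ← leviCivita_eq_covAlong, ← leviCivita_eq_covAlong, hXp y hy, hXp z hz, inner_add_left,
    inner_add_right, h.inner_mfderiv, h.inner_mfderiv, Submodule.starProjection_eq_self_iff.2 hy,
    Submodule.inner_starProjection_left_eq_right, Submodule.starProjection_eq_self_iff.2 hz] at h1
  rw [real_inner_comm (mfderiv 𝓘(ℝ, E₁) 𝓘(ℝ, E₂) F p y)]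
  linarith

/-- On horizontal vectors the second fundamental form of a Riemannian map is normal to `range F_*`: the
trilinear form `g₂((∇F_*)(x, y), F_* z)` is symmetric in `x, y` and skew in `y, z`, so it vanishes. -/
theorem IsRiemannianMap.inner_secondFF_mfderiv (h : IsRiemannianMap E₁ E₂ F)
    {x y : TangentSpace 𝓘(ℝ, E₁) p} (hx : x ∈ (kerDist E₁ E₂ F p)ᗮ)
    (hy : y ∈ (kerDist E₁ E₂ F p)ᗮ) (z : TangentSpace 𝓘(ℝ, E₁) p) :
    inner ℝ (secondFF E₁ E₂ F p x y) (mfderiv 𝓘(ℝ, E₁) 𝓘(ℝ, E₂) F p z) = 0 := by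
  rw [← mfderiv_horizontal F z]
  set w := (kerDist E₁ E₂ F p)ᗮ.starProjection z
  have hw : w ∈ (kerDist E₁ E₂ F p)ᗮ := Submodule.starProjection_apply_mem _ z
  have h1 := h.inner_secondFF_add x hy hw
  have h2 := h.inner_secondFF_add y hw hx
  have h3 := h.inner_secondFF_add w hx hy
  rw [secondFF_comm h.1 y x] at h2
  rw [secondFF_comm h.1 w x, secondFF_comm h.1 w y] at h3
  linarith

/-- `F_*` kills vertical fields, so that `(∇F_*)(v, W) = -F_*(∇_v W)` for `W` vertical; in particular this
is tangent to `range F_*`. -/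
theorem IsRiemannianMap.secondFF_vertical (h : IsRiemannianMap E₁ E₂ F)
    (v w : TangentSpace 𝓘(ℝ, E₁) p) :
    secondFF E₁ E₂ F p v ((kerDist E₁ E₂ F p).starProjection w) =
      - mfderiv 𝓘(ℝ, E₁) 𝓘(ℝ, E₂) F p
        (leviCivita (fun q => (kerDist E₁ E₂ F q).starProjection (coordField p w q)) p v) := by
  have hX := h.mdifferentiableAt_vertical w
  have h1 := covAlong_mfderiv h.1 hX v
  have hzero : ∀ q, mfderiv 𝓘(ℝ, E₁) 𝓘(ℝ, E₂) F q
      ((kerDist E₁ E₂ F q).starProjection (coordField p w q)) = 0 := fun q =>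
    mfderiv_eq_zero_of_mem_kerDist (Submodule.starProjection_apply_mem _ _)
  -- The zero field is written as `0 •` a differentiable one, to compute its derivative by Leibniz.
  have h2 := covAlong_smul (f := fun _ : M₁ => (0 : ℝ)) mdifferentiableAt_const
    (mdifferentiableAt_mfderiv_apply h.1 hX) v
  have h3 := covAlong_congr (E₁ := E₁) (E₂ := E₂) (F := F) (p := p)
    (V := fun q => mfderiv 𝓘(ℝ, E₁) 𝓘(ℝ, E₂) F q
      ((kerDist E₁ E₂ F q).starProjection (coordField p w q)))
    (W := fun q => (0 : ℝ) • mfderiv 𝓘(ℝ, E₁) 𝓘(ℝ, E₂) F q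
      ((kerDist E₁ E₂ F q).starProjection (coordField p w q)))
    (Eventually.of_forall fun q => by rw [hzero, smul_zero]) v
  rw [zero_smul, add_zero, mvfderiv_const, zero_apply, zero_smul] at h2
  rw [h3, h2, coordField_self] at h1
  exact eq_neg_of_add_eq_zero_left h1.symm

/-- Minimality of `ker F_*` says that the vertical part of the trace of `∇F_*` vanishes. -/
theorem IsRiemannianMap.sum_secondFF_vertical (h : IsRiemannianMap E₁ E₂ F)
    (hmin : IsMinimalDistribution (kerDist E₁ E₂ F)) (p : M₁) :
    ∑ i, secondFF E₁ E₂ F p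
      ((kerDist E₁ E₂ F p).starProjection (stdOrthonormalBasis ℝ (TangentSpace 𝓘(ℝ, E₁) p) i))
      ((kerDist E₁ E₂ F p).starProjection (stdOrthonormalBasis ℝ (TangentSpace 𝓘(ℝ, E₁) p) i))
      = 0 := by
  have hm := hmin p
  rw [distMeanCurvature, smul_eq_zero, inv_eq_zero, Nat.cast_eq_zero] at hm
  rcases hm with hm | hm
  · have hbot := Submodule.finrank_eq_zero.1 hm
    refine Finset.sum_eq_zero fun i _ => ?_
    have h0 : (kerDist E₁ E₂ F p).starProjection
        (stdOrthonormalBasis ℝ (TangentSpace 𝓘(ℝ, E₁) p) i) = 0 :=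
      (Submodule.mem_bot ℝ).1 (hbot.le (Submodule.starProjection_apply_mem _ _))
    rw [h0, ← secondFFBilin_apply h.1, map_zero]
  · have h2 := congrArg (mfderiv 𝓘(ℝ, E₁) 𝓘(ℝ, E₂) F p) hm
    rw [map_sum, map_zero] at h2
    rw [← neg_eq_zero, ← Finset.sum_neg_distrib, ← h2]
    refine Finset.sum_congr rfl fun i _ => ?_
    rw [h.secondFF_vertical, neg_neg, distB, ← two_smul ℝ, smul_smul, distA, one_div,
      inv_mul_cancel₀ two_ne_zero, one_smul, mfderiv_horizontal]

theorem IsRiemannianMap.tension_eq (h : IsRiemannianMap E₁ E₂ F)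
    (hmin : IsMinimalDistribution (kerDist E₁ E₂ F)) (p : M₁) :
    tension E₁ E₂ F p =
      (Module.finrank ℝ (rangeDist E₁ E₂ F p) : ℝ) • rangeMeanCurvature E₁ E₂ F p := by
  have h1 := sum_bilin_eq_add (secondFFBilin p h.1)
    (stdOrthonormalBasis ℝ (TangentSpace 𝓘(ℝ, E₁) p)) (kerDist E₁ E₂ F p)
    (stdOrthonormalBasis ℝ ↥(kerDist E₁ E₂ F p)ᗮ)
  simp only [secondFFBilin_apply] at h1
  rw [h.sum_secondFF_vertical hmin, zero_add] at h1
  rw [tension, h1, finrank_smul_rangeMeanCurvature]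

theorem IsRiemannianMap.inner_rangeMeanCurvature_mfderiv (h : IsRiemannianMap E₁ E₂ F)
    (z : TangentSpace 𝓘(ℝ, E₁) p) :
    inner ℝ (rangeMeanCurvature E₁ E₂ F p) (mfderiv 𝓘(ℝ, E₁) 𝓘(ℝ, E₂) F p z) = 0 := by
  rw [rangeMeanCurvature, real_inner_smul_left, sum_inner, Finset.sum_eq_zero, mul_zero]
  intro i _
  exact h.inner_secondFF_mfderiv (Subtype.coe_prop _) (Subtype.coe_prop _) z

/-- Weingarten's formula: the tangential part of the derivative of a field normal to `range F_*` is dual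
to the second fundamental form. -/
theorem IsRiemannianMap.inner_covAlong_mfderiv (h : IsRiemannianMap E₁ E₂ F)
    {V : Π p : M₁, TangentSpace 𝓘(ℝ, E₂) (F p)}
    (hV : MDifferentiableAt 𝓘(ℝ, E₁) 𝓘(ℝ, E₂).tangent
      (fun q => (⟨F q, V q⟩ : TangentBundle 𝓘(ℝ, E₂) M₂)) p)
    (hperp : ∀ q z, inner ℝ (V q) (mfderiv 𝓘(ℝ, E₁) 𝓘(ℝ, E₂) F q z) = 0)
    (v z : TangentSpace 𝓘(ℝ, E₁) p) :
    inner ℝ (covAlong E₁ E₂ F V p v) (mfderiv 𝓘(ℝ, E₁) 𝓘(ℝ, E₂) F p z) =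
      - inner ℝ (V p) (secondFF E₁ E₂ F p v z) := by
  have hZ := mdifferentiableAt_coordField p z
  have h1 := mvfderiv_inner hV (mdifferentiableAt_mfderiv_apply h.1 hZ) v
  simp only [hperp] at h1
  rw [mvfderiv_const, zero_apply, covAlong_mfderiv h.1 hZ, inner_add_right, hperp, coordField_self]
    at h1
  linarith

end RiemannianMaps

/-! ### Parallel pseudo-umbilical maps and their bitension field -/

section Main
variable {E₁ : Type*} [NormedAddCommGroup E₁] [NormedSpace ℝ E₁] [FiniteDimensional ℝ E₁]
  {M₁ : Type*} [TopologicalSpace M₁] [ChartedSpace E₁ M₁] [IsManifold 𝓘(ℝ, E₁) ∞ M₁]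
  [RiemannianBundle (fun p : M₁ => TangentSpace 𝓘(ℝ, E₁) p)]
  [IsContMDiffRiemannianBundle 𝓘(ℝ, E₁) ∞ E₁ (fun p : M₁ => TangentSpace 𝓘(ℝ, E₁) p)]
  {E₂ : Type*} [NormedAddCommGroup E₂] [NormedSpace ℝ E₂] [FiniteDimensional ℝ E₂]
  {M₂ : Type*} [TopologicalSpace M₂] [ChartedSpace E₂ M₂] [IsManifold 𝓘(ℝ, E₂) ∞ M₂]
  [RiemannianBundle (fun p : M₂ => TangentSpace 𝓘(ℝ, E₂) p)]
  [IsContMDiffRiemannianBundle 𝓘(ℝ, E₂) ∞ E₂ (fun p : M₂ => TangentSpace 𝓘(ℝ, E₂) p)]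
  {F : M₁ → M₂} {p : M₁}

/-- The rank of a Riemannian map is locally constant: it is the trace of the horizontal projection, hence
continuous. -/
theorem IsRiemannianMap.eventually_finrank_eq (h : IsRiemannianMap E₁ E₂ F) (p : M₁) :
    ∀ᶠ q in 𝓝 p, Module.finrank ℝ (rangeDist E₁ E₂ F q) =
      Module.finrank ℝ (rangeDist E₁ E₂ F p) := by
  let b := Module.finBasis ℝ E₁
  let t : M₁ → ℝ := fun q => ∑ i, b.coord i (trivializationAt E₁ (TangentSpace 𝓘(ℝ, E₁)) p
    ⟨q, (kerDist E₁ E₂ F q)ᗮ.starProjection (coordField p ((fiberEquiv p).symm (b i)) q)⟩).2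
  have htc : ContinuousAt t p := by
    refine tendsto_finsetSum _ fun i _ => ?_
    have h1 := ((mdifferentiableAt_totalSpace 𝓘(ℝ, E₁) _).1
      (h.mdifferentiableAt_horizontal (p := p) ((fiberEquiv p).symm (b i)))).2.continuousAt
    exact ((b.coord i).continuous_of_finiteDimensional.continuousAt).tendsto.comp h1.tendsto
  have ht : ∀ᶠ q in 𝓝 p, t q = Module.finrank ℝ (rangeDist E₁ E₂ F q) := by
    filter_upwards [eventually_mem_baseSet (E := E₁) p] with q hq
    let e := (trivializationAt E₁ (TangentSpace 𝓘(ℝ, E₁)) p).continuousLinearEquivAt ℝ q hq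
    rw [finrank_rangeDist, ← trace_starProjection,
      ← LinearMap.trace_conj' _ e.toLinearEquiv, LinearMap.trace_eq_matrix_trace ℝ b, Matrix.trace]
    refine Finset.sum_congr rfl fun i _ => ?_
    rw [Matrix.diag_apply, LinearMap.toMatrix_apply, coordField_eq_symmL p _ hq,
      ContinuousLinearEquiv.apply_symm_apply, Trivialization.symmL_apply _ hq]
    rfl
  have hcast : ContinuousAt (fun q => (Module.finrank ℝ (rangeDist E₁ E₂ F q) : ℝ)) p :=
    htc.congr ht
  have hn : ContinuousAt (fun q => Module.finrank ℝ (rangeDist E₁ E₂ F q)) p :=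
    Nat.isClosedEmbedding_coe_real.isInducing.continuousAt_iff.2 hcast
  have h0 := hn.tendsto
  rw [nhds_discrete ℕ] at h0
  exact tendsto_pure.1 h0

/-- Under the hypotheses `∇^F H₂ = -λ F_*`. On horizontal vectors this is the definition of
pseudo-umbilical; on vertical ones the left side is tangent to `range F_*` and, by Weingarten's formula
and `secondFF_vertical`, also normal to it. -/
theorem covAlong_rangeMeanCurvature (h : IsRiemannianMap E₁ E₂ F)
    (hpar : IsNormalParallel E₁ E₂ F (rangeMeanCurvature E₁ E₂ F)) {l : M₁ → ℝ}
    (hl : ∀ p : M₁, ∀ x ∈ (kerDist E₁ E₂ F p)ᗮ,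
      shapeOp E₁ E₂ F (rangeMeanCurvature E₁ E₂ F) p x = l p • mfderiv 𝓘(ℝ, E₁) 𝓘(ℝ, E₂) F p x)
    (p : M₁) (v : TangentSpace 𝓘(ℝ, E₁) p) :
    covAlong E₁ E₂ F (rangeMeanCurvature E₁ E₂ F) p v =
      - (l p • mfderiv 𝓘(ℝ, E₁) 𝓘(ℝ, E₂) F p v) := by
  set H := rangeMeanCurvature E₁ E₂ F with hH
  set K := kerDist E₁ E₂ F p with hK
  have hrange : ∀ v, (rangeDist E₁ E₂ F p).starProjection (covAlong E₁ E₂ F H p v) =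
      covAlong E₁ E₂ F H p v := fun v => by
    have h1 := (rangeDist E₁ E₂ F p).starProjection_add_starProjection_orthogonal
      (covAlong E₁ E₂ F H p v)
    have h2 := hpar.2 p v
    rw [normalCov] at h2
    rwa [h2, add_zero] at h1
  have hhor : ∀ x ∈ Kᗮ, covAlong E₁ E₂ F H p x = - (l p • mfderiv 𝓘(ℝ, E₁) 𝓘(ℝ, E₂) F p x) :=
    fun x hx => by rw [← hl p x hx, shapeOp, neg_neg, hrange]
  have hver : covAlong E₁ E₂ F H p (K.starProjection v) = 0 := by
    obtain ⟨u, hu⟩ : covAlong E₁ E₂ F H p (K.starProjection v) ∈ rangeDist E₁ E₂ F p :=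
      Submodule.starProjection_eq_self_iff.1 (hrange _)
    have h1 := h.inner_covAlong_mfderiv (hpar.1 p)
      (fun q z => h.inner_rangeMeanCurvature_mfderiv z) (K.starProjection v) u
    rw [secondFF_comm h.1, h.secondFF_vertical, inner_neg_right,
      h.inner_rangeMeanCurvature_mfderiv, neg_zero, neg_zero] at h1
    have hu' : mfderiv 𝓘(ℝ, E₁) 𝓘(ℝ, E₂) F p u = covAlong E₁ E₂ F H p (K.starProjection v) := hu
    rw [hu'] at h1
    exact inner_self_eq_zero.1 h1
  conv_lhs => rw [← K.starProjection_add_starProjection_orthogonal v, covAlong_add_apply, hver,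
    zero_add, hhor _ (Submodule.starProjection_apply_mem _ v), mfderiv_horizontal]

/-- The trace of Weingarten's formula: `r λ = r |H₂|²`. -/
theorem finrank_mul_eq (h : IsRiemannianMap E₁ E₂ F)
    (hpar : IsNormalParallel E₁ E₂ F (rangeMeanCurvature E₁ E₂ F)) {l : M₁ → ℝ}
    (hl : ∀ p : M₁, ∀ x ∈ (kerDist E₁ E₂ F p)ᗮ,
      shapeOp E₁ E₂ F (rangeMeanCurvature E₁ E₂ F) p x = l p • mfderiv 𝓘(ℝ, E₁) 𝓘(ℝ, E₂) F p x)
    (p : M₁) :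
    (Module.finrank ℝ (rangeDist E₁ E₂ F p) : ℝ) * l p =
      (Module.finrank ℝ (rangeDist E₁ E₂ F p) : ℝ) *
      inner ℝ (rangeMeanCurvature E₁ E₂ F p) (rangeMeanCurvature E₁ E₂ F p) := by
  set c := stdOrthonormalBasis ℝ ↥(kerDist E₁ E₂ F p)ᗮ with hc
  have h1 : ∀ i, l p = inner ℝ (rangeMeanCurvature E₁ E₂ F p)
      (secondFF E₁ E₂ F p (c i : TangentSpace 𝓘(ℝ, E₁) p) (c i : TangentSpace 𝓘(ℝ, E₁) p)) := by
    intro i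
    have h2 := h.inner_covAlong_mfderiv (hpar.1 p)
      (fun q z => h.inner_rangeMeanCurvature_mfderiv z) (c i : TangentSpace 𝓘(ℝ, E₁) p) (c i)
    rw [covAlong_rangeMeanCurvature h hpar hl, inner_neg_left, real_inner_smul_left,
      h.2 p _ (c i).2 _ (c i).2, ← Submodule.coe_inner, real_inner_self_eq_norm_sq,
      c.norm_eq_one] at h2
    linarith
  have h3 : ∑ i, inner ℝ (rangeMeanCurvature E₁ E₂ F p)
      (secondFF E₁ E₂ F p (c i : TangentSpace 𝓘(ℝ, E₁) p) (c i : TangentSpace 𝓘(ℝ, E₁) p)) =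
      ∑ _i : Fin (Module.finrank ℝ ↥(kerDist E₁ E₂ F p)ᗮ), l p :=
    Finset.sum_congr rfl fun i _ => (h1 i).symm
  rw [← inner_sum, ← finrank_smul_rangeMeanCurvature, real_inner_smul_right, Finset.sum_const,
    Finset.card_univ, Fintype.card_fin, nsmul_eq_mul, ← finrank_rangeDist] at h3
  exact h3.symm

/-- The second covariant derivative of `τ = r H₂`, from `∇^F τ = -r λ F_*` with `r` locally constant. -/
theorem secondCov_tension (h : IsRiemannianMap E₁ E₂ F)
    (hmin : IsMinimalDistribution (kerDist E₁ E₂ F))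
    (hpar : IsNormalParallel E₁ E₂ F (rangeMeanCurvature E₁ E₂ F)) {l : M₁ → ℝ}
    (hls : ContMDiff 𝓘(ℝ, E₁) 𝓘(ℝ, ℝ) ∞ l)
    (hl : ∀ p : M₁, ∀ x ∈ (kerDist E₁ E₂ F p)ᗮ,
      shapeOp E₁ E₂ F (rangeMeanCurvature E₁ E₂ F) p x = l p • mfderiv 𝓘(ℝ, E₁) 𝓘(ℝ, E₂) F p x)
    (p : M₁) (v w : TangentSpace 𝓘(ℝ, E₁) p) :
    secondCov E₁ E₂ F (tension E₁ E₂ F) p v w =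
      - (Module.finrank ℝ (rangeDist E₁ E₂ F p) : ℝ) •
        (mvfderiv 𝓘(ℝ, E₁) l p v • mfderiv 𝓘(ℝ, E₁) 𝓘(ℝ, E₂) F p w +
          l p • secondFF E₁ E₂ F p v w) := by
  set r : ℝ := (Module.finrank ℝ (rangeDist E₁ E₂ F p) : ℝ) with hr
  have hlp : MDifferentiableAt 𝓘(ℝ, E₁) 𝓘(ℝ, ℝ) l p := hls.contMDiffAt.mdifferentiableAt (by simp)
  -- This holds near `p` and not just at `p`, since it is differentiated below.
  have hcov : ∀ᶠ q in 𝓝 p, ∀ x : TangentSpace 𝓘(ℝ, E₁) q,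
      covAlong E₁ E₂ F (tension E₁ E₂ F) q x =
        (-r) • (l q • mfderiv 𝓘(ℝ, E₁) 𝓘(ℝ, E₂) F q x) := by
    filter_upwards [(h.eventually_finrank_eq p).eventually_nhds] with q hq x
    rw [covAlong_congr (W := fun q => r • rangeMeanCurvature E₁ E₂ F q) (hq.mono fun q' hq' => by
      rw [h.tension_eq hmin, hq']),
      covAlong_smul (f := fun _ : M₁ => r) mdifferentiableAt_const (hpar.1 q), mvfderiv_const,
      zero_apply, zero_smul, zero_add, covAlong_rangeMeanCurvature h hpar hl, smul_neg, neg_smul]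
  have hY := mdifferentiableAt_mfderiv_apply h.1 (mdifferentiableAt_coordField p w)
  have hf : MDifferentiableAt 𝓘(ℝ, E₁) 𝓘(ℝ, ℝ) ((fun _ : M₁ => -r) • l) p :=
    mdifferentiableAt_const.smul hlp
  have hf' : mvfderiv 𝓘(ℝ, E₁) ((fun _ : M₁ => -r) • l) p v = -r * mvfderiv 𝓘(ℝ, E₁) l p v := by
    rw [mvfderiv_smul mdifferentiableAt_const hlp, mvfderiv_const]
    simp
  rw [secondCov, hcov.self_of_nhds, covAlong_congr
    (W := fun q => ((fun _ : M₁ => -r) • l) q • mfderiv 𝓘(ℝ, E₁) 𝓘(ℝ, E₂) F q (coordField p w q))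
    (hcov.mono fun q hq => by rw [hq, smul_smul]; rfl), covAlong_smul hf hY, hf', coordField_self,
    secondFF]
  simp only [Pi.smul_apply', smul_eq_mul, smul_add, smul_sub, smul_smul]
  abel

/-- The `H₂`-component of the bitension field. The terms tangent to `range F_*`, among them the gradient
of `λ`, drop out. -/
theorem inner_bitension_rangeMeanCurvature (h : IsRiemannianMap E₁ E₂ F)
    (hmin : IsMinimalDistribution (kerDist E₁ E₂ F))
    (hpar : IsNormalParallel E₁ E₂ F (rangeMeanCurvature E₁ E₂ F)) {l : M₁ → ℝ}
    (hls : ContMDiff 𝓘(ℝ, E₁) 𝓘(ℝ, ℝ) ∞ l)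
    (hl : ∀ p : M₁, ∀ x ∈ (kerDist E₁ E₂ F p)ᗮ,
      shapeOp E₁ E₂ F (rangeMeanCurvature E₁ E₂ F) p x = l p • mfderiv 𝓘(ℝ, E₁) 𝓘(ℝ, E₂) F p x)
    {c : ℝ} (hc : IsSpaceForm E₂ M₂ c) (p : M₁) :
    inner ℝ (bitension E₁ E₂ F p) (rangeMeanCurvature E₁ E₂ F p) =
      (c * ∑ i, ‖mfderiv 𝓘(ℝ, E₁) 𝓘(ℝ, E₂) F p
          (stdOrthonormalBasis ℝ (TangentSpace 𝓘(ℝ, E₁) p) i)‖ ^ 2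
        - (Module.finrank ℝ (rangeDist E₁ E₂ F p) : ℝ) * l p) *
      inner ℝ (tension E₁ E₂ F p) (rangeMeanCurvature E₁ E₂ F p) := by
  set b := stdOrthonormalBasis ℝ (TangentSpace 𝓘(ℝ, E₁) p) with hb
  set H := rangeMeanCurvature E₁ E₂ F p with hH
  set r : ℝ := (Module.finrank ℝ (rangeDist E₁ E₂ F p) : ℝ) with hr
  have hFH : ∀ x, inner ℝ (mfderiv 𝓘(ℝ, E₁) 𝓘(ℝ, E₂) F p x) H = 0 := fun x => by
    rw [real_inner_comm, h.inner_rangeMeanCurvature_mfderiv]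
  have h1 : inner ℝ (∑ i, secondCov E₁ E₂ F (tension E₁ E₂ F) p (b i) (b i)) H =
      -(r * l p) * inner ℝ (tension E₁ E₂ F p) H := by
    rw [tension, sum_inner, sum_inner, Finset.mul_sum]
    refine Finset.sum_congr rfl fun i _ => ?_
    rw [secondCov_tension h hmin hpar hls hl, real_inner_smul_left, inner_add_left,
      real_inner_smul_left, real_inner_smul_left, hFH]
    ring
  have h2 : inner ℝ (∑ i, curvature (F p) (mfderiv 𝓘(ℝ, E₁) 𝓘(ℝ, E₂) F p (b i))
      (tension E₁ E₂ F p) (mfderiv 𝓘(ℝ, E₁) 𝓘(ℝ, E₂) F p (b i))) H =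
      -(c * ∑ i, ‖mfderiv 𝓘(ℝ, E₁) 𝓘(ℝ, E₂) F p (b i)‖ ^ 2) *
        inner ℝ (tension E₁ E₂ F p) H := by
    rw [sum_inner, Finset.mul_sum, ← Finset.sum_neg_distrib, Finset.sum_mul]
    refine Finset.sum_congr rfl fun i _ => ?_
    rw [hc, real_inner_smul_left, inner_sub_left, real_inner_smul_left, real_inner_smul_left, hFH,
      real_inner_self_eq_norm_sq]
    ring
  rw [bitension, laplacianAlong, neg_neg, inner_sub_left, h1, h2]
  ring

theorem IsBiharmonic.isHarmonic (hbi : IsBiharmonic E₁ E₂ F) (hF : IsRiemannianMap E₁ E₂ F)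
    (humb : IsPseudoUmbilical E₁ E₂ F) (hmin : IsMinimalDistribution (kerDist E₁ E₂ F))
    (hpar : IsNormalParallel E₁ E₂ F (rangeMeanCurvature E₁ E₂ F))
    {c : ℝ} (hc : c ≤ 0) (hM₂ : IsSpaceForm E₂ M₂ c) : IsHarmonic E₁ E₂ F := by
  intro p
  obtain ⟨l, hls, hl⟩ := humb
  have key := inner_bitension_rangeMeanCurvature hF hmin hpar hls hl hM₂ p
  have hrl := finrank_mul_eq hF hpar hl p
  have hτ := hF.tension_eq hmin p
  rw [hbi p, inner_zero_left, hrl, hτ, real_inner_smul_left] at key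
  rw [hτ, smul_eq_zero, or_iff_not_imp_left]
  intro hr
  have hr' : 0 < (Module.finrank ℝ (rangeDist E₁ E₂ F p) : ℝ) :=
    lt_of_le_of_ne (Nat.cast_nonneg _) (Ne.symm hr)
  -- If `H₂ ≠ 0`, then `c K - r |H₂|²` is negative, with `K = ∑ |F_* e_i|²`, and `key` is violated.
  by_contra hH
  have hH' : 0 < inner ℝ (rangeMeanCurvature E₁ E₂ F p) (rangeMeanCurvature E₁ E₂ F p) :=
    real_inner_self_pos.2 hH
  have hK : 0 ≤ ∑ i, ‖mfderiv 𝓘(ℝ, E₁) 𝓘(ℝ, E₂) F p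
      (stdOrthonormalBasis ℝ (TangentSpace 𝓘(ℝ, E₁) p) i)‖ ^ 2 :=
    Finset.sum_nonneg fun i _ => sq_nonneg _
  have hneg := mul_neg_of_neg_of_pos (sub_neg_of_lt
    ((mul_nonpos_of_nonpos_of_nonneg hc hK).trans_lt (mul_pos hr' hH'))) (mul_pos hr' hH')
  exact hneg.ne key.symm

end Main

end RiemMap

end

theorem corollary4p2
    {E₁ : Type*} [NormedAddCommGroup E₁] [NormedSpace ℝ E₁] [FiniteDimensional ℝ E₁]
    {M₁ : Type*} [TopologicalSpace M₁] [ChartedSpace E₁ M₁] [IsManifold 𝓘(ℝ, E₁) ∞ M₁]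
    [RiemannianBundle (fun p : M₁ => TangentSpace 𝓘(ℝ, E₁) p)]
    [IsContMDiffRiemannianBundle 𝓘(ℝ, E₁) ∞ E₁ (fun p : M₁ => TangentSpace 𝓘(ℝ, E₁) p)]
    {E₂ : Type*} [NormedAddCommGroup E₂] [NormedSpace ℝ E₂] [FiniteDimensional ℝ E₂]
    {M₂ : Type*} [TopologicalSpace M₂] [ChartedSpace E₂ M₂] [IsManifold 𝓘(ℝ, E₂) ∞ M₂]
    [RiemannianBundle (fun p : M₂ => TangentSpace 𝓘(ℝ, E₂) p)]
    [IsContMDiffRiemannianBundle 𝓘(ℝ, E₂) ∞ E₂ (fun p : M₂ => TangentSpace 𝓘(ℝ, E₂) p)]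
    (c : ℝ) (hc : c ≤ 0) (hM₂ : RiemMap.IsSpaceForm E₂ M₂ c) :
    ¬ ∃ F : M₁ → M₂,
      RiemMap.IsRiemannianMap E₁ E₂ F ∧
      RiemMap.IsPseudoUmbilical E₁ E₂ F ∧
      RiemMap.IsMinimalDistribution (RiemMap.kerDist E₁ E₂ F) ∧
      RiemMap.IsNormalParallel E₁ E₂ F (RiemMap.rangeMeanCurvature E₁ E₂ F) ∧
      RiemMap.IsProperBiharmonic E₁ E₂ F := by
  rintro ⟨F, hF, humb, hmin, hpar, hbi, hnh⟩
  exact hnh (hbi.isHarmonic hF humb hmin hpar hc hM₂)
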